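/- All logarithms are base $2$. **Slices and weights.** For $0\le r\le n$ let $\binom{[n]}{r}$ be the set of $x\in\{0,1\}^n$ with exactly $r$ ones, and $\langle g,h\rangle_r=\mathbb E[g(x)h(x)]$ for $x$ uniform on $\binom{[n]}{r}$. A *top set* of length $e$ is a sequence $B=(b_1<\dots<b_e)$ in $[n]$ for which there is a sequence $A=(a_1,\dots,a_e)$ of distinct elements of $[n]$, disjoint from $B$, with $a_i<b_i$ for all $i$ (written $A<B$). Put $\chi_B(x)=\sum_{A<B}\prod_{i=1}^e(x_{a_i}-x_{b_i})$, the sum being over all such $A$, and on $\binom{[n]}{r}$ let $\chi^{(r)}_B(x)=\chi_B(x)$ if $r\le n/2$ and $\chi^{(r)}_B(x)=\chi_B(\bar x)$ if $r>n/2$, where $\bar x$ is the complement of $x$. For $f:\{0,1\}^n\to\mathbb R$ with restriction $f|_r$ to $\binom{[n]}{r}$ and real $d$, let $$W^{>d}(f|_r)=\sum_{d<e\le\min(r,n-r)}\ \sum_{B\text{ top set of length }e}\hat f(B)^2\,\langle\chi^{(r)}_B,\chi^{(r)}_B\rangle_r,\qquad \hat f(B)=\frac{\langle f,\chi^{(r)}_B\rangle_r}{\langle\chi^{(r)}_B,\chi^{(r)}_B\rangle_r}.$$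 A Boolean function $f:\{0,1\}^n\to\{0,1\}$, with its values converted to $\pm1$ by $b\mapsto 1-2b$, is *$(t,d,\epsilon)$-concentrated* if $W^{>d}(f|_r)<\epsilon$ for some integer $r$, $0\le r\le n$, with $n/2-t/2\le r\le n/2+t/2$. **Distinguishers.** A distinguisher $D$ with $m$ samples is a Boolean circuit of fan-in at most two (AND, OR, NOT gates and constants) whose input consists of $m$ labelled examples $(x_j,h(x_j))$, where $x_1,\dots,x_m$ are independent and uniform in $\{0,1\}^n$. Its size is its number of nodes. Given a family $\{F_s:\{0,1\}^n\to\{0,1\}\}$ and a distribution $S$ on seeds $s\in\{0,1\}^k$, its advantage is $$\bigl|\Pr_{s\sim S}[D^{F_s}\text{ accepts}]-\Pr_R[D^{R}\text{ accepts}]\bigr|,$$ where $R$ is a uniformly random function $\{0,1\}^n\to\{0,1\}$ and both probabilities are also over the samples. **Proposition.** There is an absolute constant $C>0$ such that the following holds. Let $t=t(n)$ and $d=d(n)$ be real with $t\le n/4$ and $d\ge1$ for all large $n$, and $d=o(n/\log n)$. Then for every constant $\delta<1$ and all sufficiently large $n$, there is a distinguisher $D$ that uses at most $2^{C(d\log n+t^2/n)}$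 samples and has size at most $2^{C(d\log n+t^2/n)}$, such that for every family $\{F_s\}$ and every distribution $S$ on its seeds for which every $F_s$ with $s$ in the support of $S$ is $(t,d,1/2)$-concentrated, the advantage of $D$ is greater than $\delta$. In particular ($\delta=1/3$), no such family is a $(2^{C(d\log n+t^2/n)},1/3)$-secure weak pseudorandom family. -/

import Mathlib

open Filter Asymptotics

noncomputable section

namespace SliceDist

/-- The Boolean cube `{0,1}^n`. -/
abbrev Cube (n : ℕ) : Type := Fin n → Bool

/-- A bit as the real number `0` or `1`. -/
def bit (b : Bool) : ℝ := if b then 1 else 0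

/-- The conversion `b ↦ 1 - 2b` of a Boolean value to `±1`. -/
def toSign (b : Bool) : ℝ := 1 - 2 * bit b

/-- The slice of all `x ∈ {0,1}^n` with exactly `r` ones. -/
def slice (n r : ℕ) : Finset (Cube n) :=
  Finset.univ.filter fun x => (Finset.univ.filter fun i => x i = true).card = r

/-- `⟨f, g⟩ = 𝔼 f(x) g(x)` for `x` uniform on the slice of weight `r`. -/
def sliceInner {n : ℕ} (r : ℕ) (f g : Cube n → ℝ) : ℝ :=
  (∑ x ∈ slice n r, f x * g x) / ((slice n r).card : ℝ)

/-- For sequences `A`, `B` of length `e`: all entries of `A` are distinct, `A` and `B` are disjoint,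
and `A < B` entrywise. -/
def SeqBelow {n e : ℕ} (A B : Fin e → Fin n) : Prop :=
  Function.Injective A ∧ (∀ i j, A i ≠ B j) ∧ ∀ i, A i < B i

/-- Top sets of length `e`: increasing sequences `B` with some disjoint sequence `A < B`. -/
def IsTopSet {n e : ℕ} (B : Fin e → Fin n) : Prop :=
  StrictMono B ∧ ∃ A : Fin e → Fin n, SeqBelow A B

open Classical in
/-- The finite set of all top sets of length `e`. -/
def topSets (n e : ℕ) : Finset (Fin e → Fin n) :=
  Finset.univ.filter fun B => IsTopSet B

/-- `χ_{A,B}(x) = ∏ i, (x_{a_i} - x_{b_i})`. -/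
def chiPair {n e : ℕ} (A B : Fin e → Fin n) (x : Cube n) : ℝ :=
  ∏ i, (bit (x (A i)) - bit (x (B i)))

open Classical in
/-- `χ_B = ∑_{A < B} χ_{A,B}`. -/
def chi {n e : ℕ} (B : Fin e → Fin n) (x : Cube n) : ℝ :=
  ∑ A ∈ Finset.univ.filter (fun A : Fin e → Fin n => SeqBelow A B), chiPair A B x

/-- The Young–Fourier basis function of the top set `B` on the slice of weight `r`:
`χ_B(x)` if `r ≤ n/2`, and `χ_B` at the complement of `x` if `r > n/2`. -/
def sliceChi {n e : ℕ} (r : ℕ) (B : Fin e → Fin n) (x : Cube n) : ℝ :=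
  if 2 * r ≤ n then chi B x else chi B (fun i => !(x i))

/-- The Young–Fourier coefficient of `f` restricted to the slice of weight `r`. -/
def coeff {n e : ℕ} (r : ℕ) (f : Cube n → ℝ) (B : Fin e → Fin n) : ℝ :=
  sliceInner r f (sliceChi r B) / sliceInner r (sliceChi r B) (sliceChi r B)

/-- The weight `W^e` of `f` restricted to the slice of weight `r`. -/
def levelWeight {n : ℕ} (r e : ℕ) (f : Cube n → ℝ) : ℝ :=
  ∑ B ∈ topSets n e, coeff r f B ^ 2 * sliceInner r (sliceChi r B) (sliceChi r B)

/-- The weight `W^{>d}` of `f` restricted to the slice of weight `r`; the levels of the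
Young–Fourier expansion on this slice are `0, …, min r (n - r)`. -/
def weightAbove {n : ℕ} (r : ℕ) (d : ℝ) (f : Cube n → ℝ) : ℝ :=
  ∑ e ∈ (Finset.range (min r (n - r) + 1)).filter (fun e : ℕ => d < (e : ℝ)), levelWeight r e f

/-- `(t,d,ε)`-concentration of a Boolean function (with values converted to `±1`): on some slice
of weight `r ∈ [n/2 - t/2, n/2 + t/2]` its weight above level `d` is less than `ε`. -/
def IsConcentrated {n : ℕ} (t d ε : ℝ) (f : Cube n → Bool) : Prop :=
  ∃ r : ℕ, r ≤ n ∧ (n : ℝ) / 2 - t / 2 ≤ r ∧ (r : ℝ) ≤ (n : ℝ) / 2 + t / 2 ∧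
    weightAbove r d (fun x => toSign (f x)) < ε

/-- Nodes of a Boolean circuit of fan-in at most two whose input bits are indexed by `ι`.
A natural number refers to the node at that position of the circuit. -/
inductive Gate (ι : Type) : Type
  | input (i : ι)
  | const (b : Bool)
  | not (j : ℕ)
  | and (j k : ℕ)
  | or (j k : ℕ)

/-- The value of a node, given the input and the list of the values of all earlier nodes.
A reference to a node which is not earlier reads the constant `false`. -/
def Gate.eval {ι : Type} (x : ι → Bool) (v : List Bool) : Gate ι → Bool
  | .input i => x i
  | .const b => b
  | .not j => !(v.getD j false)
  | .and j k => v.getD j false && v.getD k false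
  | .or j k => v.getD j false || v.getD k false

/-- A Boolean circuit: its nodes in topological order, the last one being the output. -/
structure Circuit (ι : Type) : Type where
  nodes : List (Gate ι)

/-- The size of a circuit is its number of nodes, input nodes included. -/
def Circuit.size {ι : Type} (D : Circuit ι) : ℕ := D.nodes.length

/-- The values of all nodes on the input `x`, in order. -/
def Circuit.values {ι : Type} (D : Circuit ι) (x : ι → Bool) : List Bool :=
  D.nodes.foldl (fun v g => v ++ [g.eval x v]) []

/-- The output of the circuit on the input `x`. -/
def Circuit.eval {ι : Type} (D : Circuit ι) (x : ι → Bool) : Bool :=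
  (D.values x).getLastD false

/-- A distinguisher for functions on `{0,1}^n` that uses `m` labelled examples: a circuit that
reads, for each example `j : Fin m`, the `n` bits `(j, some i)` of the point and the bit
`(j, none)`, its label. -/
abbrev Distinguisher (n m : ℕ) : Type := Circuit (Fin m × Option (Fin n))

/-- The input bits that encode the examples `(x_j, h(x_j))`. -/
def exampleBits {n m : ℕ} (h : Cube n → Bool) (x : Fin m → Cube n) : Fin m × Option (Fin n) → Bool
  | (j, some i) => x j i
  | (j, none) => h (x j)

/-- The probability that `D` accepts when given `m` independent uniform examples of `h`. -/
def acceptProb {n m : ℕ} (D : Distinguisher n m) (h : Cube n → Bool) : ℝ :=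
  ((Finset.univ.filter fun x : Fin m → Cube n => D.eval (exampleBits h x) = true).card : ℝ) /
    (Fintype.card (Fin m → Cube n) : ℝ)

/-- The probability that `D` accepts examples of a uniformly random function, over the function
and the examples. -/
def acceptProbRandom {n m : ℕ} (D : Distinguisher n m) : ℝ :=
  (∑ R : Cube n → Bool, acceptProb D R) / (Fintype.card (Cube n → Bool) : ℝ)

/-- The probability that `D` accepts examples of `F s`, over the seed `s ∼ S` and the examples. -/
def acceptProbFamily {n m k : ℕ} (D : Distinguisher n m) (S : PMF (Cube k))
    (F : Cube k → Cube n → Bool) : ℝ :=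
  ∑ s : Cube k, (S s).toReal * acceptProb D (F s)

/-- The distinguishing advantage of `D` between `F s`, `s ∼ S`, and a uniformly random function. -/
def advantage {n m k : ℕ} (D : Distinguisher n m) (S : PMF (Cube k))
    (F : Cube k → Cube n → Bool) : ℝ :=
  |acceptProbFamily D S F - acceptProbRandom D|

end SliceDist

end

noncomputable section

namespace SliceDist

open Finset

/-! The distinguisher estimates one statistic per slice near the middle: the energy, i.e. the sum
over monomials `x_S` with `|S| = k = ⌊d⌋` of the squared correlation of `f` with `x_S` on the slice.
Expanding the square gives the sum over pairs `x, y` of the slice of `f(x) f(y) C(|x ∧ y|, k)`.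
Hence, up to the factor `4^n`, the energy is the mean of a bounded, easily computed function of two
labelled examples.

Concentrated functions have large energy. The `χ_B` form an orthogonal basis of every slice
(`sum_slice_chi_mul_chi`, `eq_zero_of_orthogonal_chi`) and have degree `e`, so weight below `1/2`
above level `d` gives a projection `g` of degree at most `k` carrying more than half of the norm of
`f` (`exists_low_of_weightAbove_lt`). On the slice `g` is homogeneous of degree `k`, and the Gram
matrix of the degree `k` monomials dominates a multiple of the identity (`choose_mul_sum_sq_le`).
Cauchy–Schwarz turns this into energy at least `C(n,r)^2 / (2 n^{2k})` (`le_energy_of_low`).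

A random function has mean energy at most `n^k C(n,r)` (`sum_energy_toSign_le`). This is far
smaller, because slices within `t/2` of the middle have size at least `2^n / ((n+1) 2^{2t²/n})`
(`two_pow_le_choose`). Chebyshev over independent pairs of examples, Markov for the random function
and a union bound over the slices separate the two cases with `2^{O(d log n + t²/n)}` samples. All
quantities are integers in a small range, so circuits carrying the indicators of their possible
values compute the test (`exists_distinguisher`). -/

/-! ### Product formula for `χ_B`. -/

/-- The affine factor that the `i`-th entry `b` of a top set contributes to `χ_B`. -/
def linFactor {n : ℕ} (i : ℕ) (b : Fin n) (x : Cube n) : ℝ :=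
  ∑ j ∈ Iio b, bit (x j) - i - ((b : ℝ) - 2 * i) * bit (x b)

theorem bit_mul_self (b : Bool) : bit b * bit b = bit b := by cases b <;> simp [bit]

theorem chiPair_mul_pair {n e : ℕ} (A B : Fin e → Fin n) (x : Cube n) (i : Fin e) :
    chiPair A B x * (bit (x (A i)) + bit (x (B i))) = chiPair A B x := by
  unfold chiPair
  rw [← mul_prod_erase univ _ (mem_univ i), mul_assoc, mul_comm (∏ j ∈ _, _), ← mul_assoc]
  congr 1
  linear_combination bit_mul_self (x (A i)) - bit_mul_self (x (B i))

open Classical in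
theorem chi_eq_sum_ite {n e : ℕ} (B : Fin e → Fin n) (x : Cube n) :
    chi B x = ∑ A : Fin e → Fin n, if SeqBelow A B then chiPair A B x else 0 := by
  rw [chi, sum_filter]

open Classical in
theorem seqBelow_snoc_iff {n e : ℕ} {B : Fin (e + 1) → Fin n} (hB : StrictMono B)
    (A : Fin e → Fin n) (a : Fin n) :
    SeqBelow (Fin.snoc (α := fun _ => Fin n) A a) B ↔
      SeqBelow A (fun i => B i.castSucc) ∧
        a ∈ Iio (B (Fin.last e)) \ (univ.image A ∪ univ.image fun i => B (Fin.castSucc i)) := by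
  have hlt : ∀ i : Fin e, B i.castSucc < B (Fin.last e) := fun i => hB (Fin.castSucc_lt_last i)
  rw [Finset.mem_sdiff, Finset.mem_union, Finset.mem_Iio]
  simp only [SeqBelow, Fin.forall_fin_succ', Fin.snoc_castSucc, Fin.snoc_last,
    Finset.mem_image, Finset.mem_univ, true_and, not_or, not_exists]
  constructor
  · rintro ⟨hi, ⟨h1, h2⟩, h3, h4⟩
    refine ⟨⟨fun i j hij => ?_, fun i => (h1 i).1, h3⟩, h4, fun i hia => ?_, fun i => (h2.1 i).symm⟩
    · have := @hi i.castSucc j.castSucc (by simpa using hij)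
      simpa using this
    · have := @hi i.castSucc (Fin.last e) (by simpa using hia)
      exact (Fin.castSucc_lt_last i).ne this
  · rintro ⟨⟨hi, h1, h2⟩, h3, h4, h5⟩
    refine ⟨fun i j => ?_, ⟨fun i => ⟨h1 i, ((h2 i).trans (hlt i)).ne⟩, fun i => (h5 i ·.symm),
      h3.ne⟩, h2, h3⟩
    refine Fin.lastCases ?_ (fun i => ?_) i <;> refine Fin.lastCases ?_ (fun j => ?_) j
    · simp
    · simpa using fun h => (h4 j h.symm).elim
    · simpa using fun h => (h4 i h).elim
    · simpa using fun h => hi h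

-- Sum over the last entry `a` first. It ranges over the positions below the last `b` except the
-- `2e` entries already used, all of which lie below `b`. Where the product of the earlier factors
-- is nonzero, each earlier pair has `x_{a_i} + x_{b_i} = 1` (`chiPair_mul_pair`), so the inner sum
-- does not depend on `A`.
open Classical in
theorem chi_succ {n e : ℕ} {B : Fin (e + 1) → Fin n} (hB : StrictMono B) (x : Cube n) :
    chi B x = chi (fun i => B i.castSucc) x * linFactor e (B (Fin.last e)) x := by
  have hlt : ∀ i : Fin e, B i.castSucc < B (Fin.last e) := fun i => hB (Fin.castSucc_lt_last i)
  rw [chi_eq_sum_ite, chi_eq_sum_ite, sum_mul,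
    ← (Fin.snocEquiv fun _ : Fin (e + 1) => Fin n).sum_comp, Fintype.sum_prod_type_right]
  refine sum_congr rfl fun A _ => ?_
  have hpair : ∀ a, chiPair (Fin.snoc (α := fun _ => Fin n) A a) B x =
      chiPair A (fun i => B i.castSucc) x * (bit (x a) - bit (x (B (Fin.last e)))) := by
    intro a
    simp [chiPair, Fin.prod_univ_castSucc]
  have hs : ∀ a, Fin.snocEquiv (fun _ : Fin (e + 1) => Fin n) (a, A) =
      Fin.snoc (α := fun _ => Fin n) A a := fun _ => rfl
  simp only [hs, seqBelow_snoc_iff hB, hpair]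
  by_cases hA : SeqBelow A fun i => B i.castSucc
  swap
  · simp [hA]
  simp only [hA, true_and, if_true]
  rw [← sum_filter, filter_mem_eq_inter, univ_inter, ← mul_sum]
  obtain ⟨hinj, hdisj, hbelow⟩ := hA
  have hBinj : Function.Injective fun i : Fin e => B i.castSucc :=
    hB.injective.comp (Fin.castSucc_injective e)
  have hd : Disjoint (univ.image A) (univ.image fun i : Fin e => B i.castSucc) := by
    rw [disjoint_left]
    simp only [mem_image, mem_univ, true_and, not_exists]
    rintro _ ⟨i, rfl⟩ j h
    exact hdisj i j h.symm
  have hsub : (univ.image A ∪ univ.image fun i : Fin e => B i.castSucc) ⊆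
      Iio (B (Fin.last e)) := by
    intro a
    simp only [mem_union, mem_image, mem_univ, true_and, mem_Iio]
    rintro (⟨i, rfl⟩ | ⟨i, rfl⟩)
    · exact (hbelow i).trans (hlt i)
    · exact hlt i
  have hsum : ∑ a ∈ Iio (B (Fin.last e)) \ (univ.image A ∪ univ.image fun i => B (Fin.castSucc i)),
        (bit (x a) - bit (x (B (Fin.last e)))) =
      ∑ j ∈ Iio (B (Fin.last e)), bit (x j) - ∑ i : Fin e, (bit (x (A i)) + bit (x (B i.castSucc)))
        - ((B (Fin.last e) : ℝ) - 2 * e) * bit (x (B (Fin.last e))) := by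
    have h1 := sum_sdiff (f := fun a => bit (x a) - bit (x (B (Fin.last e)))) hsub
    rw [sum_union hd, sum_image hinj.injOn, sum_image hBinj.injOn] at h1
    simp only [sum_sub_distrib, sum_const, Fin.card_Iio, card_univ, Fintype.card_fin,
      nsmul_eq_mul, sum_add_distrib] at h1 ⊢
    linear_combination h1
  have hq : chiPair A (fun i => B i.castSucc) x *
      ∑ i : Fin e, (bit (x (A i)) + bit (x (B i.castSucc))) =
        e * chiPair A (fun i => B i.castSucc) x := by
    rw [mul_sum, sum_congr rfl fun i _ => chiPair_mul_pair A (fun i => B i.castSucc) x i]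
    simp
  rw [hsum, linFactor]
  linear_combination -hq

theorem chi_eq_prod {n e : ℕ} {B : Fin e → Fin n} (hB : StrictMono B) (x : Cube n) :
    chi B x = ∏ i : Fin e, linFactor i (B i) x := by
  induction e with
  | zero =>
    have h : ∀ A : Fin 0 → Fin n, SeqBelow A B := fun A =>
      ⟨Function.injective_of_subsingleton A, fun i => i.elim0, fun i => i.elim0⟩
    simp [chi, h, chiPair]
  | succ e ih =>
    rw [chi_succ hB, ih (B := fun i => B i.castSucc) (hB.comp Fin.strictMono_castSucc),
      Fin.prod_univ_castSucc]
    simp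

/-! ### Low-degree polynomials and orthogonality of the `χ_B`. -/

/-- The monomial `∏ i ∈ S, x_i`. -/
def mono {n : ℕ} (S : Finset (Fin n)) (x : Cube n) : ℝ := ∏ i ∈ S, bit (x i)

/-- Polynomials of degree at most `k` on the cube. -/
def low (n k : ℕ) : Submodule ℝ (Cube n → ℝ) :=
  Submodule.span ℝ (mono '' {S : Finset (Fin n) | S.card ≤ k})

theorem mono_mul_bit {n : ℕ} (S : Finset (Fin n)) (a : Fin n) (x : Cube n) :
    mono S x * bit (x a) = mono (insert a S) x := by
  unfold mono
  by_cases h : a ∈ S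
  · rw [insert_eq_of_mem h, ← mul_prod_erase S _ h, mul_right_comm, bit_mul_self]
  · rw [prod_insert h, mul_comm]

theorem low_mono {n k l : ℕ} (h : k ≤ l) : low n k ≤ low n l :=
  Submodule.span_mono (Set.image_mono fun _ hS => le_trans hS h)

theorem mul_bit_mem_low {n k : ℕ} {g : Cube n → ℝ} (hg : g ∈ low n k) (a : Fin n) :
    (fun x => g x * bit (x a)) ∈ low n (k + 1) := by
  refine Submodule.span_induction (p := fun g _ => (fun x => g x * bit (x a)) ∈ low n (k + 1))
    ?_ ?_ ?_ ?_ hg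
  · rintro _ ⟨S, hS, rfl⟩
    simp only [mono_mul_bit]
    exact Submodule.subset_span ⟨insert a S, (card_insert_le a S).trans (by simpa using hS), rfl⟩
  · simp only [Pi.zero_apply, zero_mul]
    exact (low n (k + 1)).zero_mem
  · intro f g _ _ hf hg
    simp only [Pi.add_apply, add_mul]
    exact (low n (k + 1)).add_mem hf hg
  · intro c f _ hf
    simp only [Pi.smul_apply, smul_eq_mul, mul_assoc]
    exact (low n (k + 1)).smul_mem c hf

theorem mul_linFactor_mem_low {n k : ℕ} {g : Cube n → ℝ} (hg : g ∈ low n k) (i : ℕ) (b : Fin n) :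
    (fun x => g x * linFactor i b x) ∈ low n (k + 1) := by
  have h : (fun x => g x * linFactor i b x) =
      (∑ j ∈ Iio b, fun x => g x * bit (x j)) - (i : ℝ) • g
        - ((b : ℝ) - 2 * i) • fun x => g x * bit (x b) := by
    funext x
    simp only [linFactor, Pi.sub_apply, Finset.sum_apply, Pi.smul_apply, smul_eq_mul, ← mul_sum]
    ring
  rw [h]
  exact sub_mem (sub_mem (sum_mem fun j _ => mul_bit_mem_low hg j)
    (Submodule.smul_mem _ _ (low_mono k.le_succ hg))) (Submodule.smul_mem _ _ (mul_bit_mem_low hg b))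

theorem prod_linFactor_mem_low {n : ℕ} {ι : Type*} (s : Finset ι) (i : ι → ℕ) (b : ι → Fin n) :
    (fun x => ∏ j ∈ s, linFactor (i j) (b j) x) ∈ low n s.card := by
  classical
  induction s using Finset.induction_on with
  | empty => exact Submodule.subset_span ⟨∅, by simp, by funext x; simp [mono]⟩
  | insert a s ha ih =>
    rw [card_insert_of_notMem ha]
    simp only [prod_insert ha, mul_comm (linFactor (i a) (b a) _)]
    exact mul_linFactor_mem_low ih _ _

theorem chi_mem_low {n e : ℕ} {B : Fin e → Fin n} (hB : StrictMono B) : chi B ∈ low n e := by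
  have h := prod_linFactor_mem_low univ (fun i : Fin e => (i : ℕ)) B
  simp only [← chi_eq_prod hB, card_univ, Fintype.card_fin] at h
  exact h

theorem comp_swap_mem_slice {n r : ℕ} (a b : Fin n) {x : Cube n} :
    x ∘ Equiv.swap a b ∈ slice n r ↔ x ∈ slice n r := by
  simp only [slice, mem_filter, mem_univ, true_and, Function.comp_apply]
  rw [card_equiv (Equiv.swap a b) (t := univ.filter fun i => x i = true)]
  simp

theorem sum_slice_comp_swap {n r : ℕ} (a b : Fin n) (g : Cube n → ℝ) :
    ∑ x ∈ slice n r, g (x ∘ Equiv.swap a b) = ∑ x ∈ slice n r, g x := by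
  refine sum_nbij' (fun x => x ∘ Equiv.swap a b) (fun x => x ∘ Equiv.swap a b) ?_ ?_ ?_ ?_ ?_
  · intro x hx; exact (comp_swap_mem_slice a b).2 hx
  · intro x hx; exact (comp_swap_mem_slice a b).2 hx
  · intro x _; funext i; simp
  · intro x _; funext i; simp
  · intro x _; rfl

theorem sum_slice_eq_zero_of_swap {n r : ℕ} (a b : Fin n) {g : Cube n → ℝ}
    (h : ∀ x, g (x ∘ Equiv.swap a b) = -g x) : ∑ x ∈ slice n r, g x = 0 := by
  have := sum_slice_comp_swap (r := r) a b g
  simp only [h, sum_neg_distrib] at this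
  linarith

/-- A function that changes sign under more than `k` disjoint transpositions of coordinates is
orthogonal to all polynomials of degree at most `k`. -/
theorem sum_slice_mul_low_eq_zero {n r k K : ℕ} {A B : Fin K → Fin n}
    (hA : Function.Injective A) (hB : Function.Injective B) (hAB : ∀ i j, A i ≠ B j)
    {F : Cube n → ℝ} (hF : ∀ i x, F (x ∘ Equiv.swap (A i) (B i)) = -F x) (hk : k < K)
    {g : Cube n → ℝ} (hg : g ∈ low n k) : ∑ x ∈ slice n r, F x * g x = 0 := by
  classical
  refine Submodule.span_induction (p := fun g _ => ∑ x ∈ slice n r, F x * g x = 0)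
    ?_ ?_ ?_ ?_ hg
  · rintro _ ⟨S, hS, rfl⟩
    -- `S` has fewer elements than there are disjoint pairs, so it misses a whole pair. Swapping
    -- that pair fixes the monomial and negates `F`.
    obtain ⟨i, hiA, hiB⟩ : ∃ i, A i ∉ S ∧ B i ∉ S := by
      by_contra! h
      have hinj : Set.InjOn (fun i => if A i ∈ S then A i else B i) (univ : Finset (Fin K)) := by
        intro i _ j _ hij
        dsimp only at hij
        split_ifs at hij
        · exact hA hij
        · exact (hAB _ _ hij).elim
        · exact (hAB _ _ hij.symm).elim
        · exact hB hij
      have := card_le_card_of_injOn (t := S) _ (fun i _ => by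
        split_ifs with h1
        · exact h1
        · exact h i h1) hinj
      simp only [card_univ, Fintype.card_fin] at this
      simp only [Set.mem_ofPred_eq] at hS
      omega
    refine sum_slice_eq_zero_of_swap (A i) (B i) fun x => ?_
    have : mono S (x ∘ Equiv.swap (A i) (B i)) = mono S x := by
      refine prod_congr rfl fun j hj => ?_
      rw [Function.comp_apply, Equiv.swap_apply_of_ne_of_ne]
      · rintro rfl; exact hiA hj
      · rintro rfl; exact hiB hj
    rw [this, hF, neg_mul]
  · simp
  · intro f g _ _ hf hg
    simp [mul_add, sum_add_distrib, hf, hg]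
  · intro c f _ hf
    simp only [Pi.smul_apply, smul_eq_mul, mul_left_comm _ c, ← mul_sum, hf, mul_zero]

theorem chiPair_comp_swap {n e : ℕ} {A B : Fin e → Fin n} (hA : Function.Injective A)
    (hB : Function.Injective B) (hAB : ∀ i j, A i ≠ B j) (i : Fin e) (x : Cube n) :
    chiPair A B (x ∘ Equiv.swap (A i) (B i)) = -chiPair A B x := by
  unfold chiPair
  rw [← mul_prod_erase univ _ (mem_univ i), ← mul_prod_erase univ _ (mem_univ i), ← neg_mul]
  congr 1
  · simp
  · refine prod_congr rfl fun j hj => ?_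
    have hji : j ≠ i := ne_of_mem_erase hj
    simp [Equiv.swap_apply_of_ne_of_ne (hA.ne hji) (hAB j i),
      Equiv.swap_apply_of_ne_of_ne (hAB i j).symm (hB.ne hji)]

theorem linFactor_comp_swap {n : ℕ} {a b c : Fin n} (ha : a < c) (hb : b < c) (i : ℕ)
    (x : Cube n) : linFactor i c (x ∘ Equiv.swap a b) = linFactor i c x := by
  have h : ∑ j ∈ Iio c, bit ((x ∘ Equiv.swap a b) j) = ∑ j ∈ Iio c, bit (x j) := by
    refine sum_equiv (Equiv.swap a b) (fun j => ?_) fun j _ => rfl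
    simp only [Finset.mem_Iio]
    rcases eq_or_ne j a with rfl | hja
    · simp [ha, hb]
    rcases eq_or_ne j b with rfl | hjb
    · simp [ha, hb]
    rw [Equiv.swap_apply_of_ne_of_ne hja hjb]
  rw [linFactor, linFactor, h, Function.comp_apply, Equiv.swap_apply_of_ne_of_ne ha.ne' hb.ne']

/-- Expand only `χ_B`. The factors of `χ_{B'}` with index at least `k` are invariant under the swaps
of `a_i, b_i` for `i ≤ k`, since these positions lie below `B' i`. They are absorbed into the
antisymmetric part. At most `k` affine factors remain, against `k + 1` transpositions. -/
theorem sum_slice_chi_mul_chi_of_lt {n r e e' : ℕ} {B : Fin e → Fin n} {B' : Fin e' → Fin n}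
    (hB : StrictMono B) (hB' : StrictMono B') (k : Fin e)
    (hk : ∀ i : Fin e', (i : ℕ) < k ∨ B k < B' i) :
    ∑ x ∈ slice n r, chi B x * chi B' x = 0 := by
  classical
  simp only [chi_eq_prod hB']
  simp only [chi, sum_mul]
  rw [sum_comm]
  refine sum_eq_zero fun A hA => ?_
  obtain ⟨hinj, hdisj, hbelow⟩ := (mem_filter.1 hA).2
  have hsplit : ∀ x, chiPair A B x * ∏ i : Fin e', linFactor i (B' i) x =
      (chiPair A B x * ∏ i ∈ univ.filter (fun i : Fin e' => ¬ (i : ℕ) < k), linFactor i (B' i) x) *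
        ∏ i ∈ univ.filter (fun i : Fin e' => (i : ℕ) < k), linFactor i (B' i) x := by
    intro x
    rw [mul_assoc, mul_comm (∏ i ∈ univ.filter (fun i : Fin e' => ¬ (i : ℕ) < k), _),
      prod_filter_mul_prod_filter_not]
  simp only [hsplit]
  let ι : Fin (k + 1) → Fin e := Fin.castLE k.2
  have hι : Function.Injective ι := Fin.castLE_injective k.2
  refine sum_slice_mul_low_eq_zero (A := A ∘ ι) (B := B ∘ ι) (k := k) (hinj.comp hι)
    (hB.injective.comp hι) (fun i j => hdisj _ _) ?_ (Nat.lt_succ_self _)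
    (low_mono ?_ (prod_linFactor_mem_low _ _ _))
  · intro i x
    simp only [Function.comp_apply]
    rw [chiPair_comp_swap hinj hB.injective hdisj, neg_mul]
    congr 2
    refine prod_congr rfl fun j hj => ?_
    have hj' : B k < B' j := (hk j).resolve_left (mem_filter.1 hj).2
    have hi : B (ι i) ≤ B k := hB.monotone (Fin.le_def.2 (Nat.lt_succ_iff.1 i.2))
    exact linFactor_comp_swap ((hbelow _).trans_le hi |>.trans hj') (hi.trans_lt hj') _ _
  · have := card_le_card_of_injOn (s := univ.filter fun i : Fin e' => (i : ℕ) < k)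
      (t := range k) (fun i => (i : ℕ)) (fun i hi => by simpa using hi)
      (fun i _ j _ h => Fin.ext h)
    simpa using this

/-- The functions `χ_B` are pairwise orthogonal on every slice. -/
theorem sum_slice_chi_mul_chi {n r e e' : ℕ} {B : Fin e → Fin n} {B' : Fin e' → Fin n}
    (hB : StrictMono B) (hB' : StrictMono B')
    (hne : (⟨e, B⟩ : Σ e, Fin e → Fin n) ≠ ⟨e', B'⟩) :
    ∑ x ∈ slice n r, chi B x * chi B' x = 0 := by
  have comm : ∑ x ∈ slice n r, chi B x * chi B' x = ∑ x ∈ slice n r, chi B' x * chi B x :=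
    sum_congr rfl fun x _ => mul_comm _ _
  rcases lt_trichotomy e e' with h | h | h
  · rw [comm]
    exact sum_slice_chi_mul_chi_of_lt hB' hB ⟨e, h⟩ fun i => Or.inl i.2
  · subst h
    obtain ⟨k, hk⟩ : ∃ k, B k ≠ B' k := by
      by_contra! h
      exact hne (by rw [funext h])
    rcases lt_or_gt_of_ne hk with h | h
    · exact sum_slice_chi_mul_chi_of_lt hB hB' k fun i => (lt_or_ge i k).imp id
        fun hi => h.trans_le (hB'.monotone hi)
    · rw [comm]
      exact sum_slice_chi_mul_chi_of_lt hB' hB k fun i => (lt_or_ge i k).imp id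
        fun hi => h.trans_le (hB.monotone hi)
  · exact sum_slice_chi_mul_chi_of_lt hB hB' ⟨e', h⟩ fun i => Or.inl i.2

/-! ### Completeness of the `χ_B` on a slice. -/

/-- The number of ones of a point of the cube. -/
def wt {n : ℕ} (x : Cube n) : ℕ := (univ.filter fun i => x i = true).card

theorem mem_slice {n r : ℕ} {x : Cube n} : x ∈ slice n r ↔ wt x = r := by simp [slice, wt]

theorem sum_bit {n : ℕ} (x : Cube n) : ∑ i, bit (x i) = wt x := by
  simp [wt, bit]

theorem wt_snoc {n : ℕ} (x : Cube n) (b : Bool) :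
    wt (Fin.snoc (α := fun _ => Bool) x b) = wt x + b.toNat := by
  have h := sum_bit (Fin.snoc (α := fun _ => Bool) x b)
  rw [Fin.sum_univ_castSucc] at h
  simp only [Fin.snoc_castSucc, Fin.snoc_last, sum_bit] at h
  have : bit b = (b.toNat : ℝ) := by cases b <;> simp [bit]
  rw [this] at h
  exact_mod_cast h.symm

theorem wt_compl_add {n : ℕ} (x : Cube n) : wt (fun i => !(x i)) + wt x = n := by
  have h := sum_add_distrib (s := univ) (f := fun i => bit (!(x i))) (g := fun i => bit (x i))
  have h1 : ∀ b : Bool, bit (!b) + bit b = 1 := by intro b; cases b <;> simp [bit]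
  rw [sum_bit x, sum_bit fun i => !(x i), sum_congr rfl fun i _ => h1 (x i)] at h
  simp only [sum_const, card_univ, Fintype.card_fin, nsmul_eq_mul, mul_one] at h
  exact_mod_cast h.symm

theorem chi_compl {n e : ℕ} (B : Fin e → Fin n) (x : Cube n) :
    chi B (fun i => !(x i)) = (-1) ^ e * chi B x := by
  classical
  unfold chi
  rw [mul_sum]
  refine sum_congr rfl fun A _ => ?_
  have : ∀ b c : Bool, bit (!b) - bit (!c) = (-1) * (bit b - bit c) := by
    intro b c; cases b <;> cases c <;> simp [bit]
  simp only [chiPair, this, prod_mul_distrib, prod_const, card_univ, Fintype.card_fin]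

/-- A nonzero summand requires a one of `x` in each of the `e` disjoint pairs. -/
theorem chi_eq_zero_of_wt_lt {n e : ℕ} {B : Fin e → Fin n} (hB : StrictMono B) {x : Cube n}
    (h : wt x < e) : chi B x = 0 := by
  classical
  unfold chi
  refine sum_eq_zero fun A hA => ?_
  obtain ⟨hinj, hdisj, -⟩ := (mem_filter.1 hA).2
  by_contra hne
  have hx : ∀ i, x (A i) ≠ x (B i) := by
    intro i hi
    exact hne (prod_eq_zero (mem_univ i) (by rw [hi, sub_self]))
  have hmap : Set.InjOn (fun i => if x (A i) then A i else B i) (univ : Finset (Fin e)) := by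
    intro i _ j _ hij
    dsimp only at hij
    split_ifs at hij
    · exact hinj hij
    · exact (hdisj _ _ hij).elim
    · exact (hdisj _ _ hij.symm).elim
    · exact hB.injective hij
  have := card_le_card_of_injOn (t := univ.filter fun i => x i = true) _ (fun i _ => by
    have := hx i
    split_ifs with h1
    · simpa using h1
    · cases h2 : x (B i) <;> simp_all) hmap
  simp only [card_univ, Fintype.card_fin] at this
  exact absurd this (not_le.2 h)

theorem chi_eq_zero_of_lt_add {n e : ℕ} {B : Fin e → Fin n} (hB : StrictMono B) {x : Cube n}
    (h : n < e + wt x) : chi B x = 0 := by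
  have h1 := chi_eq_zero_of_wt_lt hB (x := fun i => !(x i)) (by have := wt_compl_add x; omega)
  rw [chi_compl] at h1
  simpa using h1

theorem isTopSet_zero {n : ℕ} (B : Fin 0 → Fin n) : IsTopSet B :=
  ⟨fun i => i.elim0, B, Function.injective_of_subsingleton B, fun i => i.elim0, fun i => i.elim0⟩

theorem IsTopSet.castSucc {n e : ℕ} {B : Fin e → Fin n} (h : IsTopSet B) :
    IsTopSet fun i => (B i).castSucc := by
  obtain ⟨hB, A, hA, hAB, hlt⟩ := h
  exact ⟨Fin.strictMono_castSucc.comp hB, fun i => (A i).castSucc,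
    (Fin.castSucc_injective n).comp hA, fun i j => by simpa using hAB i j,
    fun i => by simpa using hlt i⟩

theorem strictMono_snoc_last {n e : ℕ} {B : Fin e → Fin n} (hB : StrictMono B) :
    StrictMono (Fin.snoc (α := fun _ => Fin (n + 1)) (fun i => (B i).castSucc) (Fin.last n)) := by
  intro i j
  refine Fin.lastCases (fun h => ?_) (fun i => ?_) i
  · exact absurd h (not_lt.2 (Fin.le_last _))
  refine Fin.lastCases (fun _ => ?_) (fun j h => ?_) j
  · simp [Fin.castSucc_lt_last]
  · simpa using hB (by simpa using h)

theorem IsTopSet.snoc_last {n e : ℕ} {B : Fin e → Fin n} (h : IsTopSet B) (hn : 2 * e < n) :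
    IsTopSet (Fin.snoc (α := fun _ => Fin (n + 1)) (fun i => (B i).castSucc) (Fin.last n)) := by
  classical
  obtain ⟨hB, A, hA, hAB, hlt⟩ := h
  refine ⟨strictMono_snoc_last hB, ?_⟩
  obtain ⟨a, ha⟩ : ∃ a, a ∉ univ.image A ∪ univ.image B := by
    by_contra! hall
    have h1 : (univ : Finset (Fin n)) ⊆ univ.image A ∪ univ.image B := fun a _ => hall a
    have h2 := (card_le_card h1).trans (card_union_le _ _)
    have h3 := card_image_le (s := univ) (f := A)
    have h4 := card_image_le (s := univ) (f := B)
    simp only [card_univ, Fintype.card_fin] at h2 h3 h4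
    omega
  refine ⟨Fin.snoc (α := fun _ => Fin (n + 1)) (fun i => (A i).castSucc) a.castSucc, ?_⟩
  rw [seqBelow_snoc_iff (strictMono_snoc_last hB)]
  simp only [Fin.snoc_castSucc, Fin.snoc_last]
  refine ⟨⟨(Fin.castSucc_injective n).comp hA, fun i j => by simpa using hAB i j,
    fun i => by simpa using hlt i⟩, ?_⟩
  simpa [Fin.castSucc_lt_last] using ha

theorem linFactor_castSucc {n : ℕ} (i : ℕ) (c : Fin n) (x : Cube n) (b : Bool) :
    linFactor i c.castSucc (Fin.snoc (α := fun _ => Bool) x b) = linFactor i c x := by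
  have h : ∑ j ∈ Iio c.castSucc, bit (Fin.snoc (α := fun _ => Bool) x b j) =
      ∑ j ∈ Iio c, bit (x j) := by
    rw [Fin.Iio_castSucc, sum_map]
    simp
  rw [linFactor, linFactor, h, Fin.snoc_castSucc, Fin.val_castSucc]

theorem linFactor_last {n : ℕ} (i : ℕ) (x : Cube n) (b : Bool) :
    linFactor i (Fin.last n) (Fin.snoc (α := fun _ => Bool) x b) =
      wt x - i - ((n : ℝ) - 2 * i) * bit b := by
  have h : ∑ j ∈ Iio (Fin.last n), bit (Fin.snoc (α := fun _ => Bool) x b j) = wt x := by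
    rw [Fin.Iio_last_eq_map, sum_map, ← sum_bit]
    simp
  rw [linFactor, h, Fin.snoc_last, Fin.val_last]

theorem chi_castSucc {n e : ℕ} {B : Fin e → Fin n} (hB : StrictMono B) (x : Cube n) (b : Bool) :
    chi (fun i => (B i).castSucc) (Fin.snoc (α := fun _ => Bool) x b) = chi B x := by
  rw [chi_eq_prod hB, chi_eq_prod (B := fun i => (B i).castSucc) (Fin.strictMono_castSucc.comp hB)]
  simp only [linFactor_castSucc]

theorem chi_snoc_last {n e : ℕ} {B : Fin e → Fin n} (hB : StrictMono B) (x : Cube n) (b : Bool) :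
    chi (Fin.snoc (α := fun _ => Fin (n + 1)) (fun i => (B i).castSucc) (Fin.last n))
      (Fin.snoc (α := fun _ => Bool) x b) =
        chi B x * (wt x - e - ((n : ℝ) - 2 * e) * bit b) := by
  rw [chi_succ (strictMono_snoc_last hB)]
  simp only [Fin.snoc_castSucc, Fin.snoc_last]
  rw [chi_castSucc hB, linFactor_last]

theorem sum_slice_succ {n r : ℕ} (g : Cube (n + 1) → ℝ) :
    ∑ x ∈ slice (n + 1) r, g x =
      ∑ x ∈ slice n r, g (Fin.snoc (α := fun _ => Bool) x false) +
        ∑ x : Cube n with wt x + 1 = r, g (Fin.snoc (α := fun _ => Bool) x true) := by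
  have h : ∀ m r, slice m r = univ.filter fun x => wt x = r := by
    intro m r; ext x; simp [mem_slice]
  rw [h, h, sum_filter, sum_filter, sum_filter,
    ← (Fin.snocEquiv fun _ : Fin (n + 1) => Bool).sum_comp, Fintype.sum_prod_type]
  have hs : ∀ b (x : Cube n), Fin.snocEquiv (fun _ : Fin (n + 1) => Bool) (b, x) =
      Fin.snoc (α := fun _ => Bool) x b := fun _ _ => rfl
  simp [hs, wt_snoc, add_comm]

/-- A function orthogonal to all `χ_B` on a slice vanishes on it. -/
theorem eq_zero_of_orthogonal_chi {n r : ℕ} {f : Cube n → ℝ}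
    (h : ∀ e, e ≤ r → e + r ≤ n → ∀ B : Fin e → Fin n, IsTopSet B →
      ∑ x ∈ slice n r, f x * chi B x = 0) :
    ∀ x ∈ slice n r, f x = 0 := by
  induction n generalizing r with
  | zero =>
    intro x hx
    have hr : wt x = r := mem_slice.1 hx
    have hr0 : r = 0 := by rw [← hr]; simp [wt]
    subst hr0
    have h1 := h 0 le_rfl le_rfl Fin.elim0 (isTopSet_zero _)
    rw [sum_eq_single x (fun y _ hy => (hy (Subsingleton.elim _ _)).elim) (fun hx' => (hx' hx).elim),
      chi_eq_prod (isTopSet_zero _).1] at h1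
    simpa using h1
  | succ n ih =>
    set f₀ : Cube n → ℝ := fun x => f (Fin.snoc (α := fun _ => Bool) x false)
    set f₁ : Cube n → ℝ := fun x => f (Fin.snoc (α := fun _ => Bool) x true)
    -- Induction on the last coordinate. A top set `B` of `[n]` gives two test functions on the
    -- larger cube: `B` itself, and `B` with the new last position appended. The condition `wt x + 1
    -- = r` avoids truncated subtraction at `r = 0`.
    have hu : ∀ e, e ≤ r → e + r ≤ n + 1 → ∀ B : Fin e → Fin n, IsTopSet B →
        ∑ x ∈ slice n r, f₀ x * chi B x +
          ∑ x : Cube n with wt x + 1 = r, f₁ x * chi B x = 0 := by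
      intro e he her B hB
      have := h e he her _ hB.castSucc
      rw [sum_slice_succ] at this
      simpa only [chi_castSucc hB.1] using this
    have hv : ∀ e, e + 1 ≤ r → e + r ≤ n → ∀ B : Fin e → Fin n, IsTopSet B →
        ((r : ℝ) - e) * ∑ x ∈ slice n r, f₀ x * chi B x -
          ((n : ℝ) + 1 - r - e) * ∑ x : Cube n with wt x + 1 = r, f₁ x * chi B x = 0 := by
      intro e he her B hB
      have := h (e + 1) he (by omega) _ (hB.snoc_last (by omega))
      rw [sum_slice_succ] at this
      simp only [chi_snoc_last hB.1] at this
      rw [← this, mul_sum, mul_sum, sub_eq_add_neg, ← sum_neg_distrib]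
      congr 1
      · refine sum_congr rfl fun x hx => ?_
        rw [mem_slice.1 hx]
        simp [f₀, bit]
        ring
      · refine sum_congr rfl fun x hx => ?_
        rw [← (mem_filter.1 hx).2]
        simp [f₁, bit]
        ring
    -- The two equations in the two partial sums have determinant `-(n + 1 - 2e)`, which is nonzero
    -- here.
    have hboth : ∀ e, e + 1 ≤ r → e + r ≤ n → ∀ B : Fin e → Fin n, IsTopSet B →
        ∑ x ∈ slice n r, f₀ x * chi B x = 0 ∧
          ∑ x : Cube n with wt x + 1 = r, f₁ x * chi B x = 0 := by
      intro e he her B hB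
      have h1 := hu e (by omega) (by omega) B hB
      have h2 := hv e he her B hB
      have hpos : (0 : ℝ) < (n : ℝ) + 1 - 2 * e := by
        have : 2 * e + 1 ≤ n := by omega
        have : (2 * e + 1 : ℝ) ≤ n := by exact_mod_cast this
        linarith
      have h3 : ((n : ℝ) + 1 - 2 * e) * ∑ x ∈ slice n r, f₀ x * chi B x = 0 := by
        linear_combination h2 + ((n : ℝ) + 1 - r - e) * h1
      have h4 := (mul_eq_zero.1 h3).resolve_left hpos.ne'
      exact ⟨h4, by rw [h4, zero_add] at h1; exact h1⟩
    intro x hx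
    have hxr := mem_slice.1 hx
    rw [← Fin.snoc_init_self x] at hxr ⊢
    set y : Cube n := Fin.init x
    have hw := wt_snoc y (x (Fin.last n))
    cases hb : x (Fin.last n) with
    | false =>
      rw [hb] at hxr hw
      have hy : wt y = r := by simpa using hw.symm.trans hxr
      refine ih (f := f₀) (r := r) (fun e he her B hB => ?_) y (mem_slice.2 hy)
      by_cases h1 : e + 1 ≤ r
      · exact (hboth e h1 her B hB).1
      -- Boundary case `e = r`: the appended top set is not available, but `χ_B` vanishes on the
      -- slice of weight `r - 1`, so the first equation suffices. The case `e + r = n + 1` below is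
      -- symmetric.
      · have h2 : ∑ x : Cube n with wt x + 1 = r, f₁ x * chi B x = 0 := by
          refine sum_eq_zero fun z hz => ?_
          rw [chi_eq_zero_of_wt_lt hB.1, mul_zero]
          have := (mem_filter.1 hz).2
          omega
        simpa [h2] using hu e he (by omega) B hB
    | true =>
      rw [hb] at hxr hw
      have hy : wt y + 1 = r := by simpa using hw.symm.trans hxr
      refine ih (f := f₁) (r := wt y) (fun e he her B hB => ?_) y (mem_slice.2 rfl)
      have hs : slice n (wt y) = univ.filter fun x : Cube n => wt x + 1 = r := by
        ext z; simp [mem_slice, ← hy]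
      rw [hs]
      by_cases h1 : e + r ≤ n
      · exact (hboth e (by omega) h1 B hB).2
      · have h2 : ∑ x ∈ slice n r, f₀ x * chi B x = 0 := by
          refine sum_eq_zero fun z hz => ?_
          rw [chi_eq_zero_of_lt_add hB.1, mul_zero]
          have := mem_slice.1 hz
          omega
        simpa [h2] using hu e (by omega) (by omega) B hB

/-! ### Young–Fourier expansion, Parseval and the low-degree projection. -/

theorem card_slice (n r : ℕ) : (slice n r).card = n.choose r := by
  have h := card_powersetCard r (univ : Finset (Fin n))
  rw [card_fin] at h
  rw [← h]
  refine card_nbij' (fun x => univ.filter fun i => x i = true) (fun S i => decide (i ∈ S))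
    ?_ ?_ ?_ ?_
  · intro x hx
    simpa [mem_powersetCard, slice] using hx
  · intro S hS
    simpa [mem_powersetCard, slice] using hS
  · intro x _; funext i; simp
  · intro S _; ext i; simp

/-- Complementing `x` multiplies `χ_B` by `(-1)^e`, which the squares cancel. From here on the two
cases of `sliceChi` are treated alike. -/
theorem coeff_sq_mul {n e : ℕ} (r : ℕ) (f : Cube n → ℝ) (B : Fin e → Fin n) :
    coeff r f B ^ 2 * sliceInner r (sliceChi r B) (sliceChi r B) =
      (∑ x ∈ slice n r, f x * chi B x) ^ 2 / (∑ x ∈ slice n r, chi B x * chi B x) /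
        (slice n r).card := by
  have key : ∀ a N s : ℝ, ((a / s) / (N / s)) ^ 2 * (N / s) = a ^ 2 / N / s := by
    intro a N s
    rcases eq_or_ne s 0 with rfl | hs
    · simp
    rcases eq_or_ne N 0 with rfl | hN
    · simp
    field_simp
  obtain ⟨c, hc, hchi⟩ : ∃ c : ℝ, c ^ 2 = 1 ∧ ∀ x, sliceChi r B x = c * chi B x := by
    by_cases h : 2 * r ≤ n
    · exact ⟨1, by simp, fun x => by simp [sliceChi, h]⟩
    · exact ⟨(-1) ^ e, by simp [← pow_mul, mul_comm e], fun x => by simp [sliceChi, h, chi_compl]⟩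
  simp only [coeff, sliceInner, hchi]
  rw [key, sum_congr rfl fun x _ => mul_left_comm (f x) c (chi B x), ← mul_sum,
    sum_congr rfl fun x _ => show c * chi B x * (c * chi B x) = chi B x * chi B x by
      linear_combination (chi B x * chi B x) * hc]
  rw [mul_pow, hc, one_mul]

/-- All top sets whose basis function is part of the basis of the slice of weight `r`. -/
def sliceIndex (n r : ℕ) : Finset (Σ e, Fin e → Fin n) :=
  (range (min r (n - r) + 1)).sigma (topSets n)

theorem mem_sliceIndex {n r : ℕ} {p : Σ e, Fin e → Fin n} :
    p ∈ sliceIndex n r ↔ p.1 < min r (n - r) + 1 ∧ IsTopSet p.2 := by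
  simp [sliceIndex, topSets]

/-- The unnormalized Young–Fourier coefficient. -/
def chiCoeff {n : ℕ} (r : ℕ) (f : Cube n → ℝ) (p : Σ e, Fin e → Fin n) : ℝ :=
  (∑ x ∈ slice n r, f x * chi p.2 x) / ∑ x ∈ slice n r, chi p.2 x * chi p.2 x

/-- If the norm is zero, `χ_B` vanishes on the slice and both sides are zero. So it is never
necessary to show that `χ_B` is nonzero there. -/
theorem chiCoeff_mul_norm {n : ℕ} (r : ℕ) (f : Cube n → ℝ) (p : Σ e, Fin e → Fin n) :
    chiCoeff r f p * ∑ x ∈ slice n r, chi p.2 x * chi p.2 x = ∑ x ∈ slice n r, f x * chi p.2 x := by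
  unfold chiCoeff
  by_cases hN : ∑ x ∈ slice n r, chi p.2 x * chi p.2 x = 0
  · rw [hN, mul_zero]
    rw [sum_eq_zero_iff_of_nonneg fun x _ => mul_self_nonneg _] at hN
    exact (sum_eq_zero fun x hx => by rw [mul_self_eq_zero.1 (hN x hx), mul_zero]).symm
  · exact div_mul_cancel₀ _ hN

/-- The part of the Young–Fourier expansion with index set `J`. -/
def chiPart {n : ℕ} (r : ℕ) (f : Cube n → ℝ) (J : Finset (Σ e, Fin e → Fin n)) (x : Cube n) : ℝ :=
  ∑ p ∈ J, chiCoeff r f p * chi p.2 x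

theorem sum_chiPart_mul_chi {n r : ℕ} (f : Cube n → ℝ) {J : Finset (Σ e, Fin e → Fin n)}
    (hJ : J ⊆ sliceIndex n r) {p : Σ e, Fin e → Fin n} (hp : p ∈ J) :
    ∑ x ∈ slice n r, chiPart r f J x * chi p.2 x = ∑ x ∈ slice n r, f x * chi p.2 x := by
  unfold chiPart
  simp only [sum_mul]
  rw [sum_comm, sum_eq_single p]
  · rw [← chiCoeff_mul_norm r f p, mul_sum]
    exact sum_congr rfl fun x _ => mul_assoc _ _ _
  · intro q hq hqp
    simp only [mul_assoc, ← mul_sum]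
    rw [sum_slice_chi_mul_chi (mem_sliceIndex.1 (hJ hq)).2.1 (mem_sliceIndex.1 (hJ hp)).2.1 hqp,
      mul_zero]
  · exact fun h => (h hp).elim

theorem eq_chiPart {n r : ℕ} (f : Cube n → ℝ) :
    ∀ x ∈ slice n r, f x = chiPart r f (sliceIndex n r) x := by
  intro x hx
  refine sub_eq_zero.1 (eq_zero_of_orthogonal_chi
    (f := fun x => f x - chiPart r f (sliceIndex n r) x) (fun e he her B hB => ?_) x hx)
  have hp : (⟨e, B⟩ : Σ e, Fin e → Fin n) ∈ sliceIndex n r :=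
    mem_sliceIndex.2 ⟨Nat.lt_succ_iff.2 (le_min he (Nat.le_sub_of_add_le her)), hB⟩
  simp only [sub_mul, sum_sub_distrib]
  rw [sum_chiPart_mul_chi f Subset.rfl hp, sub_self]

theorem sum_mul_chiPart {n r : ℕ} (f : Cube n → ℝ) (J : Finset (Σ e, Fin e → Fin n)) :
    ∑ x ∈ slice n r, f x * chiPart r f J x =
      ∑ p ∈ J, (∑ x ∈ slice n r, f x * chi p.2 x) ^ 2 /
        ∑ x ∈ slice n r, chi p.2 x * chi p.2 x := by
  unfold chiPart
  simp only [mul_sum]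
  rw [sum_comm]
  refine sum_congr rfl fun p _ => ?_
  simp only [mul_left_comm (f _), ← mul_sum]
  rw [chiCoeff]
  ring

theorem sum_chiPart_mul_chiPart {n r : ℕ} (f : Cube n → ℝ) {J : Finset (Σ e, Fin e → Fin n)}
    (hJ : J ⊆ sliceIndex n r) :
    ∑ x ∈ slice n r, chiPart r f J x * chiPart r f J x =
      ∑ x ∈ slice n r, f x * chiPart r f J x := by
  have h : ∀ g : Cube n → ℝ, ∑ x ∈ slice n r, g x * chiPart r f J x =
      ∑ p ∈ J, chiCoeff r f p * ∑ x ∈ slice n r, g x * chi p.2 x := by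
    intro g
    unfold chiPart
    simp only [mul_sum]
    rw [sum_comm]
    simp only [mul_left_comm (g _)]
  rw [h, h]
  exact sum_congr rfl fun p hp => by rw [sum_chiPart_mul_chi f hJ hp]

theorem weightAbove_eq {n r : ℕ} (d : ℝ) (f : Cube n → ℝ) :
    weightAbove r d f = (∑ p ∈ (sliceIndex n r).filter (fun p => d < (p.1 : ℝ)),
      (∑ x ∈ slice n r, f x * chi p.2 x) ^ 2 / ∑ x ∈ slice n r, chi p.2 x * chi p.2 x) /
        (slice n r).card := by
  simp only [weightAbove, levelWeight, coeff_sq_mul]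
  rw [sum_filter, sum_filter, sliceIndex, sum_sigma, sum_div]
  refine sum_congr rfl fun e _ => ?_
  by_cases h : d < (e : ℝ)
  · simp [h, sum_div]
  · simp [h]

/-- If the weight of a `±1`-valued function above level `d` is less than `1/2` on a slice, then on
this slice it has a projection of degree at most `d` which carries more than half of its norm. -/
theorem exists_low_of_weightAbove_lt {n r : ℕ} (hr : r ≤ n) {d : ℝ}
    {f : Cube n → ℝ} (hf : ∀ x, f x * f x = 1) (hw : weightAbove r d f < 1 / 2) :
    ∃ g ∈ low n ⌊d⌋₊, ∑ x ∈ slice n r, g x * g x = ∑ x ∈ slice n r, f x * g x ∧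
      (n.choose r : ℝ) / 2 < ∑ x ∈ slice n r, g x * g x := by
  have hsub := filter_subset (fun p : Σ e, Fin e → Fin n => ¬ d < (p.1 : ℝ)) (sliceIndex n r)
  refine ⟨chiPart r f ((sliceIndex n r).filter fun p => ¬ d < (p.1 : ℝ)), ?_,
    sum_chiPart_mul_chiPart f hsub, ?_⟩
  · have : chiPart r f ((sliceIndex n r).filter fun p => ¬ d < (p.1 : ℝ)) =
        ∑ p ∈ (sliceIndex n r).filter fun p => ¬ d < (p.1 : ℝ), chiCoeff r f p • chi p.2 := by
      funext x
      simp [chiPart, Finset.sum_apply]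
    rw [this]
    refine sum_mem fun p hp => Submodule.smul_mem _ _ ?_
    obtain ⟨hp1, hp2⟩ := mem_filter.1 hp
    exact low_mono (Nat.le_floor (not_lt.1 hp2)) (chi_mem_low (mem_sliceIndex.1 hp1).2.1)
  · have hpos : (0 : ℝ) < n.choose r := by exact_mod_cast Nat.choose_pos hr
    have h1 : (n.choose r : ℝ) = ∑ p ∈ sliceIndex n r, (∑ x ∈ slice n r, f x * chi p.2 x) ^ 2 /
        ∑ x ∈ slice n r, chi p.2 x * chi p.2 x := by
      rw [← sum_mul_chiPart, ← sum_congr rfl fun x hx => congrArg (f x * ·) (eq_chiPart f x hx)]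
      simp [hf, card_slice]
    rw [weightAbove_eq, card_slice, div_lt_iff₀ hpos] at hw
    rw [sum_chiPart_mul_chiPart f hsub, sum_mul_chiPart]
    rw [← sum_filter_add_sum_filter_not _ (fun p => d < (p.1 : ℝ))] at h1
    linarith

/-! ### Homogeneous polynomials on a slice and their Gram matrix. -/

theorem mono_eq_ite {n : ℕ} (S : Finset (Fin n)) (x : Cube n) :
    mono S x = if ∀ i ∈ S, x i = true then 1 else 0 := by
  simp only [mono, bit]
  rw [prod_ite_zero]
  simp

theorem mono_mul_mono {n : ℕ} (S T : Finset (Fin n)) (x : Cube n) :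
    mono S x * mono T x = mono (S ∪ T) x := by
  simp only [mono_eq_ite, mem_union, or_imp, forall_and]
  split_ifs <;> simp_all

/-- Functions which agree on the slice of weight `r` with a homogeneous polynomial of degree `k`. -/
def homOn (n r k : ℕ) : Submodule ℝ (Cube n → ℝ) where
  carrier := {g | ∃ a : Finset (Fin n) → ℝ, ∀ x ∈ slice n r,
    g x = ∑ S ∈ powersetCard k univ, a S * mono S x}
  zero_mem' := ⟨0, by simp⟩
  add_mem' := by
    rintro f g ⟨a, ha⟩ ⟨b, hb⟩
    exact ⟨a + b, fun x hx => by simp [ha x hx, hb x hx, add_mul, sum_add_distrib]⟩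
  smul_mem' := by
    rintro c g ⟨a, ha⟩
    exact ⟨c • a, fun x hx => by simp [ha x hx, mul_assoc, mul_sum]⟩

theorem homOn_congr {n r k : ℕ} {f g : Cube n → ℝ} (hg : g ∈ homOn n r k)
    (h : ∀ x ∈ slice n r, f x = g x) : f ∈ homOn n r k := by
  obtain ⟨a, ha⟩ := hg
  exact ⟨a, fun x hx => (h x hx).trans (ha x hx)⟩

theorem mono_mem_homOn {n r : ℕ} (S : Finset (Fin n)) : mono S ∈ homOn n r S.card := by
  refine ⟨fun T => if T = S then 1 else 0, fun x _ => ?_⟩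
  simp [mem_powersetCard]

/-- On the slice `∑_{i ∉ S} x_i x_S = (r - |S|) x_S`, and the factor is nonzero. -/
theorem mono_mem_homOn_succ {n r : ℕ} {S : Finset (Fin n)} (h : S.card < r) :
    mono S ∈ homOn n r (S.card + 1) := by
  have hr : ((r : ℝ) - S.card) ≠ 0 := by
    have : (S.card : ℝ) < r := by exact_mod_cast h
    linarith
  refine homOn_congr (g := ((r : ℝ) - S.card)⁻¹ • ∑ i ∈ Sᶜ, mono (insert i S))
    (Submodule.smul_mem _ _ (sum_mem fun i hi => ?_)) fun x hx => ?_
  · rw [← card_insert_of_notMem (mem_compl.1 hi)]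
    exact mono_mem_homOn _
  · have h1 : ∑ i ∈ Sᶜ, mono S x * bit (x i) + ∑ i ∈ S, mono S x * bit (x i) =
        mono S x * r := by
      rw [sum_compl_add_sum, ← mul_sum, sum_bit, mem_slice.1 hx]
    have h2 : ∑ i ∈ S, mono S x * bit (x i) = S.card * mono S x := by
      rw [sum_congr rfl fun i hi => by rw [mono_mul_bit, insert_eq_of_mem hi]]
      simp
    rw [h2] at h1
    simp only [Pi.smul_apply, Finset.sum_apply, smul_eq_mul, ← mono_mul_bit]
    field_simp
    linarith

theorem homOn_le_succ {n r k : ℕ} (h : k < r) : homOn n r k ≤ homOn n r (k + 1) := by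
  rintro g ⟨a, ha⟩
  refine homOn_congr (g := ∑ S ∈ powersetCard k univ, a S • mono S)
    (sum_mem fun S hS => Submodule.smul_mem _ _ ?_) fun x hx => ?_
  · obtain ⟨-, rfl⟩ := mem_powersetCard.1 hS
    exact mono_mem_homOn_succ h
  · simp [ha x hx, Finset.sum_apply]

theorem homOn_le {n r j k : ℕ} (hjk : j ≤ k) (hk : k ≤ r) : homOn n r j ≤ homOn n r k := by
  induction k, hjk using Nat.le_induction with
  | base => exact le_rfl
  | succ k _ ih => exact (ih (by omega)).trans (homOn_le_succ (by omega))

theorem low_le_homOn {n r k : ℕ} (hk : k ≤ r) : low n k ≤ homOn n r k := by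
  refine Submodule.span_le.2 ?_
  rintro _ ⟨S, hS, rfl⟩
  exact homOn_le hS hk (mono_mem_homOn S)

/-- Counting by the zero set of `x`, an `(n - r)`-subset of `Uᶜ`, puts `|U|` only into the upper
index, as the Vandermonde identity requires. -/
theorem sum_slice_mono {n r : ℕ} (hr : r ≤ n) (U : Finset (Fin n)) :
    ∑ x ∈ slice n r, mono U x = ((n - U.card).choose (n - r) : ℝ) := by
  have hU : (Uᶜ).card = n - U.card := by rw [card_compl, Fintype.card_fin]
  simp only [mono_eq_ite, sum_boole]
  rw [← hU, ← card_powersetCard]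
  congr 1
  refine card_nbij' (fun x => univ.filter fun i => x i = false) (fun S i => decide (i ∉ S))
    ?_ ?_ ?_ ?_
  · intro x hx
    obtain ⟨hx1, hx2⟩ := mem_filter.1 hx
    have h1 := mem_slice.1 hx1
    have h2 := wt_compl_add x
    simp only [wt, Bool.not_eq_true'] at h1 h2
    refine mem_coe.2 (mem_powersetCard.2 ⟨fun i hi => ?_, by dsimp only; omega⟩)
    simp only [mem_filter, mem_univ, true_and] at hi
    exact mem_compl.2 fun hiU => by simp [hx2 i hiU] at hi
  · intro S hS
    obtain ⟨hS1, hS2⟩ := mem_powersetCard.1 (mem_coe.1 hS)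
    refine mem_coe.2 (mem_filter.2 ⟨mem_slice.2 ?_, fun i hi => ?_⟩)
    · have : (univ.filter fun i => decide (i ∉ S) = true) = Sᶜ := by ext i; simp
      rw [wt, this, card_compl, Fintype.card_fin]
      omega
    · simpa using fun h => mem_compl.1 (hS1 h) hi
  · intro x _; funext i; cases h : x i <;> simp [h]
  · intro S _; ext i; simp

/-- The Gram matrix of the monomials of degree `k` on a slice is bounded from below by a multiple of
the identity. -/
theorem choose_mul_sum_sq_le {n r k : ℕ} (hk : k ≤ r) (hkr : k + r ≤ n)
    (a : Finset (Fin n) → ℝ) :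
    ((n - 2 * k).choose (n - r - k) : ℝ) * ∑ S ∈ powersetCard k univ, a S ^ 2 ≤
      ∑ x ∈ slice n r, (∑ S ∈ powersetCard k univ, a S * mono S x) ^ 2 := by
  set P : Finset (Finset (Fin n)) := powersetCard k univ with hP
  -- Since `n - |S ∪ T| = |S ∩ T| + (n - 2k)`, Vandermonde writes the Gram entry as a nonnegative
  -- combination of the numbers of `j`-sets `J` contained in both `S` and `T`. Each such count is a
  -- positive semidefinite matrix in `S, T`.
  have hcount : ∀ S ∈ P, ∀ T ∈ P, ∑ x ∈ slice n r, mono (S ∪ T) x =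
      ∑ j ∈ range (n - r + 1), ((n - 2 * k).choose (n - r - j) : ℝ) *
        ∑ J ∈ powersetCard j univ, (if J ⊆ S then 1 else 0) * if J ⊆ T then 1 else 0 := by
    intro S hS T hT
    have hSc := (mem_powersetCard.1 hS).2
    have hTc := (mem_powersetCard.1 hT).2
    have h1 := card_union_add_card_inter S T
    have h2 := card_le_univ (S ∪ T)
    rw [Fintype.card_fin] at h2
    rw [sum_slice_mono (by omega), show n - (S ∪ T).card = (S ∩ T).card + (n - 2 * k) by omega,
      Nat.add_choose_eq, Nat.sum_antidiagonal_eq_sum_range_succ_mk]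
    push_cast
    refine sum_congr rfl fun j _ => ?_
    rw [mul_comm]
    congr 1
    rw [← card_powersetCard, show powersetCard j (S ∩ T) =
      (powersetCard j univ).filter (fun J => J ⊆ S ∧ J ⊆ T) by
        ext J; simp [mem_powersetCard, subset_inter_iff, and_comm]]
    rw [← sum_boole]
    refine sum_congr rfl fun J _ => ?_
    split_ifs <;> simp_all
  have hsq : ∀ u : Finset (Fin n) → ℝ, (∑ S ∈ P, u S) ^ 2 = ∑ S ∈ P, ∑ T ∈ P, u S * u T := by
    intro u
    rw [sq, sum_mul_sum]
  have hexp : ∑ x ∈ slice n r, (∑ S ∈ P, a S * mono S x) ^ 2 =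
      ∑ j ∈ range (n - r + 1), ((n - 2 * k).choose (n - r - j) : ℝ) *
        ∑ J ∈ powersetCard j univ, (∑ S ∈ P, a S * if J ⊆ S then 1 else 0) ^ 2 := by
    have h1 : ∑ x ∈ slice n r, (∑ S ∈ P, a S * mono S x) ^ 2 =
        ∑ S ∈ P, ∑ T ∈ P, a S * a T * ∑ x ∈ slice n r, mono (S ∪ T) x := by
      simp only [hsq, mul_sum, ← mono_mul_mono]
      rw [sum_comm]
      refine sum_congr rfl fun S _ => ?_
      rw [sum_comm]
      exact sum_congr rfl fun T _ => sum_congr rfl fun x _ => by ring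
    rw [h1, sum_congr rfl fun S hS => sum_congr rfl fun T hT => by rw [hcount S hS T hT]]
    simp only [hsq, mul_sum]
    rw [sum_congr rfl fun S _ => sum_comm, sum_comm]
    refine sum_congr rfl fun j _ => ?_
    rw [sum_congr rfl fun S _ => sum_comm, sum_comm]
    refine sum_congr rfl fun J _ => sum_congr rfl fun S _ => sum_congr rfl fun T _ => by ring
  rw [hexp]
  -- For `j = k`, `J ⊆ S` forces `J = S`, so this term is the identity matrix; the others are
  -- dropped.
  have hterm : ∑ J ∈ P, (∑ S ∈ P, a S * if J ⊆ S then 1 else 0) ^ 2 = ∑ S ∈ P, a S ^ 2 := by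
    refine sum_congr rfl fun J hJ => ?_
    rw [sum_eq_single J]
    · simp
    · intro S hS hne
      rw [if_neg, mul_zero]
      intro hsub
      refine hne (eq_of_subset_of_card_le hsub ?_).symm
      rw [(mem_powersetCard.1 hS).2, (mem_powersetCard.1 hJ).2]
    · exact fun h => (h hJ).elim
  rw [← hterm, hP]
  exact single_le_sum (f := fun j => ((n - 2 * k).choose (n - r - j) : ℝ) *
    ∑ J ∈ powersetCard j univ, (∑ S ∈ P, a S * if J ⊆ S then 1 else 0) ^ 2)
    (fun j _ => mul_nonneg (Nat.cast_nonneg _) (sum_nonneg fun _ _ => sq_nonneg _))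
    (mem_range.2 (show k < n - r + 1 by omega))

theorem choose_le_pow_mul_choose {n r k : ℕ} (hk : k ≤ r) (hkr : k + r ≤ n) :
    n.choose r ≤ n ^ (2 * k) * (n - 2 * k).choose (r - k) := by
  induction k generalizing n r with
  | zero => simp
  | succ k ih =>
    obtain ⟨r, rfl⟩ : ∃ s, r = s + 1 := ⟨r - 1, by omega⟩
    obtain ⟨n, rfl⟩ : ∃ m, n = m + 2 := ⟨n - 2, by omega⟩
    have h1 : (n + 2).choose (r + 1) ≤ (n + 2) * (n + 1).choose r := by
      have := Nat.add_one_mul_choose_eq (n + 1) r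
      nlinarith [Nat.zero_le ((n + 2).choose (r + 1) * r)]
    have h2 : (n + 1).choose r ≤ (n + 2) * n.choose r := by
      have h := Nat.choose_mul_succ_eq n r
      have h3 : 1 ≤ n + 1 - r := by omega
      calc (n + 1).choose r ≤ (n + 1).choose r * (n + 1 - r) := Nat.le_mul_of_pos_right _ h3
        _ = n.choose r * (n + 1) := h.symm
        _ ≤ (n + 2) * n.choose r := by rw [mul_comm]; gcongr; omega
    have h3 := ih (n := n) (r := r) (by omega) (by omega)
    calc (n + 2).choose (r + 1) ≤ (n + 2) * ((n + 2) * (n ^ (2 * k) * (n - 2 * k).choose (r - k))) :=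
          h1.trans (Nat.mul_le_mul_left _ (h2.trans (Nat.mul_le_mul_left _ h3)))
      _ ≤ (n + 2) * ((n + 2) * ((n + 2) ^ (2 * k) * (n - 2 * k).choose (r - k))) := by
          gcongr; omega
      _ = (n + 2) ^ (2 * (k + 1)) * (n + 2 - 2 * (k + 1)).choose (r + 1 - (k + 1)) := by
          rw [show n + 2 - 2 * (k + 1) = n - 2 * k by omega, show r + 1 - (k + 1) = r - k by omega]
          ring

/-! ### Energy of concentrated and of random functions. -/

/-- The energy of `f` on the monomials of degree `k`, over the slice of weight `r`. -/
def energy {n : ℕ} (r k : ℕ) (f : Cube n → ℝ) : ℝ :=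
  ∑ S ∈ powersetCard k (univ : Finset (Fin n)), (∑ x ∈ slice n r, f x * mono S x) ^ 2

theorem energy_nonneg {n : ℕ} (r k : ℕ) (f : Cube n → ℝ) : 0 ≤ energy r k f :=
  sum_nonneg fun _ _ => sq_nonneg _

/-- A function that has a large projection of degree at most `k` has large energy. -/
theorem le_energy_of_low {n r k : ℕ} (hk : k ≤ r) (hkr : k + r ≤ n) {f g : Cube n → ℝ}
    (hg : g ∈ low n k) (hfg : ∑ x ∈ slice n r, g x * g x = ∑ x ∈ slice n r, f x * g x)
    (h : (n.choose r : ℝ) / 2 < ∑ x ∈ slice n r, g x * g x) :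
    (n.choose r : ℝ) ^ 2 ≤ 2 * n ^ (2 * k) * energy r k f := by
  obtain ⟨a, ha⟩ := low_le_homOn hk hg
  set G := ∑ x ∈ slice n r, g x * g x with hG
  have hG0 : 0 < G := lt_of_le_of_lt (by positivity) h
  set c : ℝ := ((n - 2 * k).choose (r - k) : ℝ) with hc
  have hc0 : 0 ≤ c := Nat.cast_nonneg _
  have h1 : c * ∑ S ∈ powersetCard k univ, a S ^ 2 ≤ G := by
    have h := choose_mul_sum_sq_le hk hkr a
    rw [show n - r - k = n - 2 * k - (r - k) by omega, Nat.choose_symm (by omega)] at h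
    refine h.trans_eq (sum_congr rfl fun x hx => ?_)
    rw [ha x hx, sq]
  have h2 : G = ∑ S ∈ powersetCard k univ, a S * ∑ x ∈ slice n r, f x * mono S x := by
    rw [hfg, sum_congr rfl fun x hx => by rw [ha x hx]]
    simp only [mul_sum]
    rw [sum_comm]
    simp only [mul_left_comm (f _)]
  have h3 : G ^ 2 ≤ (∑ S ∈ powersetCard k univ, a S ^ 2) * energy r k f := by
    rw [h2]
    exact sum_mul_sq_le_sq_mul_sq _ _ _
  -- Combine `G² ≤ (∑ a_S²) · energy` with the Gram bound `c ∑ a_S² ≤ G` and cancel `G > 0`.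
  have h4 : c * G ≤ energy r k f := by
    have : G * (c * G) ≤ G * energy r k f := by
      calc G * (c * G) = c * G ^ 2 := by ring
        _ ≤ c * ((∑ S ∈ powersetCard k univ, a S ^ 2) * energy r k f) := by gcongr
        _ = (c * ∑ S ∈ powersetCard k univ, a S ^ 2) * energy r k f := by ring
        _ ≤ G * energy r k f := mul_le_mul_of_nonneg_right h1 (energy_nonneg _ _ _)
    exact le_of_mul_le_mul_left this hG0
  have h5 : (n.choose r : ℝ) ≤ (n : ℝ) ^ (2 * k) * c := by
    rw [hc]
    exact_mod_cast choose_le_pow_mul_choose hk hkr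
  calc (n.choose r : ℝ) ^ 2 = (n.choose r : ℝ) * n.choose r := sq _
    _ ≤ ((n : ℝ) ^ (2 * k) * c) * (2 * G) := by gcongr; linarith
    _ = 2 * n ^ (2 * k) * (c * G) := by ring
    _ ≤ 2 * n ^ (2 * k) * energy r k f := by gcongr

theorem IsConcentrated.le_energy {n : ℕ} {t d : ℝ} {f : Cube n → Bool}
    (h : IsConcentrated t d (1 / 2) f) : ∃ r : ℕ, r ≤ n ∧ (n : ℝ) / 2 - t / 2 ≤ r ∧
      (r : ℝ) ≤ (n : ℝ) / 2 + t / 2 ∧ (⌊d⌋₊ ≤ r → ⌊d⌋₊ + r ≤ n →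
        (n.choose r : ℝ) ^ 2 ≤ 2 * n ^ (2 * ⌊d⌋₊) * energy r ⌊d⌋₊ fun x => toSign (f x)) := by
  obtain ⟨r, hr, h1, h2, hw⟩ := h
  refine ⟨r, hr, h1, h2, fun hk hkr => ?_⟩
  obtain ⟨g, hg, hfg, hlt⟩ := exists_low_of_weightAbove_lt hr
    (fun x => by cases f x <;> (simp [toSign, bit]; try norm_num)) hw
  exact le_energy_of_low hk hkr hg hfg hlt

theorem toSign_mul_self (b : Bool) : toSign b * toSign b = 1 := by
  cases b <;> norm_num [toSign, bit]

theorem toSign_not (b : Bool) : toSign (!b) = -toSign b := by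
  cases b <;> norm_num [toSign, bit]

theorem sum_toSign_mul_toSign {α : Type*} [Fintype α] [DecidableEq α] (x y : α) :
    ∑ R : α → Bool, toSign (R x) * toSign (R y) =
      if x = y then (Fintype.card (α → Bool) : ℝ) else 0 := by
  split_ifs with h
  · subst h
    simp [toSign_mul_self]
  -- Flipping the value of `R` at `x` alone is an involution that negates the summand.
  · have h1 : ∑ R : α → Bool, toSign (R x) * toSign (R y) =
        ∑ R : α → Bool, -(toSign (R x) * toSign (R y)) := by
      refine sum_nbij' (fun R => Function.update R x (!(R x)))
        (fun R => Function.update R x (!(R x))) ?_ ?_ ?_ ?_ ?_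
      · simp
      · simp
      · intro R _; simp
      · intro R _; simp
      · intro R _
        simp [Function.update_of_ne (Ne.symm h), toSign_not]
    rw [sum_neg_distrib] at h1
    linarith

/-- The average energy of a uniformly random `±1`-valued function is small. -/
theorem sum_energy_toSign_le {n : ℕ} (r k : ℕ) :
    ∑ R : Cube n → Bool, energy r k (fun x => toSign (R x)) ≤
      Fintype.card (Cube n → Bool) * (n ^ k * n.choose r : ℝ) := by
  have h1 : ∀ S : Finset (Fin n),
      ∑ R : Cube n → Bool, (∑ x ∈ slice n r, toSign (R x) * mono S x) ^ 2 ≤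
        Fintype.card (Cube n → Bool) * (n.choose r : ℝ) := by
    intro S
    have h2 : ∑ R : Cube n → Bool, (∑ x ∈ slice n r, toSign (R x) * mono S x) ^ 2 =
        ∑ x ∈ slice n r, ∑ y ∈ slice n r,
          mono S x * mono S y * ∑ R : Cube n → Bool, toSign (R x) * toSign (R y) := by
      simp only [sq, sum_mul_sum]
      rw [sum_comm]
      refine sum_congr rfl fun x _ => ?_
      rw [sum_comm]
      refine sum_congr rfl fun y _ => ?_
      rw [mul_sum]
      exact sum_congr rfl fun R _ => by ring
    rw [h2]
    simp only [sum_toSign_mul_toSign, mul_ite, mul_zero, sum_ite_eq]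
    rw [← card_slice, mul_comm, ← nsmul_eq_mul]
    refine sum_le_card_nsmul _ _ _ fun x hx => ?_
    rw [if_pos hx, mono_eq_ite]
    split_ifs <;> simp
  unfold energy
  rw [sum_comm]
  have h2 := sum_le_card_nsmul (powersetCard k (univ : Finset (Fin n))) _ _ fun S _ => h1 S
  rw [card_powersetCard, card_fin, nsmul_eq_mul] at h2
  refine h2.trans ?_
  have h3 : (n.choose k : ℝ) ≤ (n : ℝ) ^ k := by exact_mod_cast Nat.choose_le_pow n k
  calc (n.choose k : ℝ) * (Fintype.card (Cube n → Bool) * (n.choose r : ℝ)) ≤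
      (n : ℝ) ^ k * (Fintype.card (Cube n → Bool) * (n.choose r : ℝ)) := by gcongr
    _ = _ := by ring

/-! ### Chebyshev's inequality and the test on pairs of examples. -/

/-- Cross terms vanish because `h` has mean zero. The extra factor `card Ω` on the left avoids the
exponent `N - 1`. -/
theorem sum_sq_sum_mul_card {Ω : Type*} [Fintype Ω] (h : Ω → ℝ) (h0 : ∑ a, h a = 0) (N : ℕ) :
    (∑ ω : Fin N → Ω, (∑ j, h (ω j)) ^ 2) * Fintype.card Ω =
      N * Fintype.card Ω ^ N * ∑ a, h a ^ 2 := by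
  induction N with
  | zero => simp
  | succ N ih =>
    have hsum : ∑ ω : Fin (N + 1) → Ω, (∑ j, h (ω j)) ^ 2 =
        Fintype.card Ω ^ N * ∑ a, h a ^ 2 +
          Fintype.card Ω * ∑ ω : Fin N → Ω, (∑ j, h (ω j)) ^ 2 := by
      rw [← (Fin.consEquiv fun _ : Fin (N + 1) => Ω).sum_comp, Fintype.sum_prod_type]
      have hc : ∀ a (ω : Fin N → Ω), Fin.consEquiv (fun _ : Fin (N + 1) => Ω) (a, ω) =
          Fin.cons (α := fun _ => Ω) a ω := fun _ _ => rfl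
      simp only [hc, Fin.sum_univ_succ, Fin.cons_zero, Fin.cons_succ, add_sq, sum_add_distrib,
        sum_const, card_univ, Fintype.card_pi_const, nsmul_eq_mul, mul_assoc, ← mul_sum]
      rw [← sum_mul, h0]
      push_cast
      ring
    rw [hsum, add_mul, mul_assoc, mul_assoc, ih]
    push_cast
    ring

/-- Chebyshev's inequality for a sum of independent bounded variables, in counting form. -/
theorem card_deviation_mul_sq_le {Ω : Type*} [Fintype Ω] [Nonempty Ω] {h : Ω → ℝ} {K : ℝ}
    (hK : ∀ a, |h a| ≤ K) {μ : ℝ} (hμ : ∑ a, h a = Fintype.card Ω * μ) (N : ℕ) {a : ℝ}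
    (ha : 0 ≤ a) :
    ((univ.filter fun ω : Fin N → Ω => a ≤ |∑ j, h (ω j) - N * μ|).card : ℝ) * a ^ 2 ≤
      Fintype.card (Fin N → Ω) * (N * K ^ 2) := by
  have hΩ : (0 : ℝ) < Fintype.card Ω := by exact_mod_cast Fintype.card_pos
  have h1 := sum_sq_sum_mul_card (fun a => h a - μ) (by simp [hμ]) N
  have h2 : ∑ a, (h a - μ) ^ 2 ≤ Fintype.card Ω * K ^ 2 := by
    have h3 : ∑ a, (h a - μ) ^ 2 = ∑ a, h a ^ 2 - Fintype.card Ω * μ ^ 2 := by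
      simp only [sub_sq, sum_add_distrib, sum_sub_distrib, sum_const, card_univ, nsmul_eq_mul,
        ← sum_mul, ← mul_sum, hμ]
      ring
    have h4 : ∑ a, h a ^ 2 ≤ Fintype.card Ω * K ^ 2 := by
      rw [← nsmul_eq_mul, ← card_univ]
      exact sum_le_card_nsmul _ _ _ fun a _ => by
        rw [← sq_abs]
        exact pow_le_pow_left₀ (abs_nonneg _) (hK a) 2
    nlinarith [mul_nonneg hΩ.le (sq_nonneg μ)]
  have h5 : ((univ.filter fun ω : Fin N → Ω => a ≤ |∑ j, h (ω j) - N * μ|).card : ℝ) * a ^ 2 ≤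
      ∑ ω : Fin N → Ω, (∑ j, (h (ω j) - μ)) ^ 2 := by
    rw [← nsmul_eq_mul]
    refine (card_nsmul_le_sum _ (fun ω : Fin N → Ω => (∑ j, (h (ω j) - μ)) ^ 2) _
      fun ω hω => ?_).trans (sum_le_univ_sum_of_nonneg fun _ => sq_nonneg _)
    have := (mem_filter.1 hω).2
    rw [← sq_abs (∑ j, _), sum_sub_distrib]
    simp only [sum_const, card_univ, Fintype.card_fin, nsmul_eq_mul]
    exact pow_le_pow_left₀ ha this 2
  refine h5.trans (le_of_mul_le_mul_right ?_ hΩ)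
  rw [h1, Fintype.card_pi_const]
  push_cast
  calc (N : ℝ) * Fintype.card Ω ^ N * ∑ a, (h a - μ) ^ 2 ≤
      N * Fintype.card Ω ^ N * (Fintype.card Ω * K ^ 2) := by gcongr
    _ = _ := by ring

/-- The number of common ones of two points of the cube. -/
def common {n : ℕ} (x y : Cube n) : ℕ := (univ.filter fun i => x i = true ∧ y i = true).card

/-- The contribution of a pair of labelled examples to the test on the slice of weight `r`. -/
def pairStat {n : ℕ} (r k : ℕ) (h : Cube n → Bool) (p : Cube n × Cube n) : ℤ :=
  if wt p.1 = r ∧ wt p.2 = r then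
    (if h p.1 = h p.2 then 1 else -1) * ((common p.1 p.2).choose k : ℤ) else 0

theorem abs_pairStat_le {n : ℕ} (r k : ℕ) (h : Cube n → Bool) (p : Cube n × Cube n) :
    |pairStat r k h p| ≤ (n ^ k : ℕ) := by
  have h1 : ((common p.1 p.2).choose k : ℤ) ≤ (n ^ k : ℕ) := by
    have : common p.1 p.2 ≤ n := (card_le_univ _).trans_eq (Fintype.card_fin n)
    exact_mod_cast (Nat.choose_le_pow _ _).trans (Nat.pow_le_pow_left this k)
  unfold pairStat
  split_ifs
  · simpa using h1
  · simpa using h1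
  · simp

theorem sum_mono_mul_mono {n : ℕ} (k : ℕ) (x y : Cube n) :
    ∑ S ∈ powersetCard k univ, mono S x * mono S y = ((common x y).choose k : ℝ) := by
  rw [common, ← card_powersetCard, sum_congr rfl fun S _ => show mono S x * mono S y =
    if S ⊆ univ.filter (fun i => x i = true ∧ y i = true) then 1 else 0 by
      simp only [mono_eq_ite, subset_iff, mem_filter, mem_univ, true_and, imp_and, forall_and]
      split_ifs <;> simp_all, sum_boole]
  congr 2
  ext S
  simp [mem_powersetCard, and_comm]

/-- Makes `pairStat` an unbiased estimator of the energy divided by `4^n`; the binomial coefficient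
counts the monomials that are one at both points. -/
theorem sum_pairStat {n : ℕ} (r k : ℕ) (h : Cube n → Bool) :
    ∑ p, (pairStat r k h p : ℝ) = energy r k fun x => toSign (h x) := by
  have hs : slice n r = univ.filter fun x => wt x = r := by ext x; simp [mem_slice]
  have h1 : energy r k (fun x => toSign (h x)) = ∑ x ∈ slice n r, ∑ y ∈ slice n r,
      toSign (h x) * toSign (h y) * ((common x y).choose k : ℝ) := by
    simp only [energy, sq, sum_mul_sum, ← sum_mono_mul_mono]
    rw [sum_comm]
    refine sum_congr rfl fun x _ => ?_
    rw [sum_comm]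
    refine sum_congr rfl fun y _ => ?_
    rw [mul_sum]
    exact sum_congr rfl fun S _ => by ring
  rw [h1, Fintype.sum_prod_type, hs, sum_filter]
  refine sum_congr rfl fun x _ => ?_
  rw [sum_filter]
  by_cases hx : wt x = r
  · rw [if_pos hx]
    refine sum_congr rfl fun y _ => ?_
    by_cases hy : wt y = r
    · have hb : ∀ b c : Bool, toSign b * toSign c = if b = c then 1 else -1 := by
        intro b c; cases b <;> cases c <;> norm_num [toSign, bit]
      simp [pairStat, hx, hy, hb]
    · simp [pairStat, hy]
  · simp [pairStat, hx]

/-- The test: for some `r ∈ Rs` the statistic on the slice of weight `r` reaches its threshold. -/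
def TestAccepts {n N : ℕ} (k : ℕ) (Rs : Finset ℕ) (τ : ℕ → ℝ) (h : Cube n → Bool)
    (ω : Fin N → Cube n × Cube n) : Prop :=
  ∃ r ∈ Rs, N * τ r ≤ ((∑ j, pairStat r k h (ω j) : ℤ) : ℝ)

open Classical in
/-- The acceptance probability of the test on independent uniform pairs of points. -/
def testProb {n : ℕ} (N k : ℕ) (Rs : Finset ℕ) (τ : ℕ → ℝ) (h : Cube n → Bool) : ℝ :=
  ((univ.filter fun ω : Fin N → Cube n × Cube n => TestAccepts k Rs τ h ω).card : ℝ) /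
    Fintype.card (Fin N → Cube n × Cube n)

theorem card_cube_prod (n : ℕ) : (Fintype.card (Cube n × Cube n) : ℝ) = 4 ^ n := by
  simp only [Fintype.card_prod, Fintype.card_pi_const, Fintype.card_bool]
  push_cast
  rw [← mul_pow]
  norm_num

theorem card_pairStat_deviation_le {n N : ℕ} (hN : 0 < N) (r k : ℕ) (h : Cube n → Bool) {a : ℝ}
    (ha : 0 < a) :
    ((univ.filter fun ω : Fin N → Cube n × Cube n => N * a ≤
      |∑ j, (pairStat r k h (ω j) : ℝ) -
        N * (energy r k (fun x => toSign (h x)) / 4 ^ n)|).card : ℝ) ≤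
      Fintype.card (Fin N → Cube n × Cube n) * (n ^ (2 * k) / (N * a ^ 2)) := by
  have hN' : (0 : ℝ) < N := by exact_mod_cast hN
  have h1 := card_deviation_mul_sq_le (h := fun p => (pairStat r k h p : ℝ)) (K := (n : ℝ) ^ k)
    (fun p => by
      have := abs_pairStat_le r k h p
      exact_mod_cast this)
    (μ := energy r k (fun x => toSign (h x)) / 4 ^ n)
    (by rw [sum_pairStat, card_cube_prod]; field_simp) N (a := N * a) (by positivity)
  rw [← le_div_iff₀ (by positivity)] at h1
  refine h1.trans_eq ?_
  rw [pow_mul', mul_div_assoc]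
  congr 1
  field_simp

/-- The mean is at least twice the threshold, so rejection forces a deviation of at least `N τ r`.
In `testProb_le` the mean is at most half the threshold, which costs the factor `4`. -/
theorem le_testProb {n N k r : ℕ} (hN : 0 < N) {Rs : Finset ℕ} (hr : r ∈ Rs) {τ : ℕ → ℝ}
    (hτ : 0 < τ r) {h : Cube n → Bool}
    (he : 2 * τ r * 4 ^ n ≤ energy r k fun x => toSign (h x)) :
    1 - n ^ (2 * k) / (N * τ r ^ 2) ≤ testProb N k Rs τ h := by
  classical
  have hcard : (0 : ℝ) < Fintype.card (Fin N → Cube n × Cube n) := by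
    exact_mod_cast Fintype.card_pos
  have h1 := card_pairStat_deviation_le hN r k h hτ
  rw [testProb, le_div_iff₀ hcard]
  have h2 := card_filter_add_card_filter_not (s := (univ : Finset (Fin N → Cube n × Cube n)))
    (fun ω => TestAccepts k Rs τ h ω)
  have h3 : (univ.filter fun ω : Fin N → Cube n × Cube n => ¬ TestAccepts k Rs τ h ω).card ≤
      (univ.filter fun ω : Fin N → Cube n × Cube n => N * τ r ≤
      |∑ j, (pairStat r k h (ω j) : ℝ) -
        N * (energy r k (fun x => toSign (h x)) / 4 ^ n)|).card := by
    refine card_le_card fun ω hω => ?_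
    simp only [mem_filter, mem_univ, true_and, TestAccepts, not_exists, not_and, not_le] at hω ⊢
    have h4 := hω r hr
    push_cast at h4
    have h5 : 2 * τ r ≤ energy r k (fun x => toSign (h x)) / 4 ^ n :=
      (le_div_iff₀ (by positivity)).2 he
    have h6 : (N : ℝ) * (2 * τ r) ≤ N * (energy r k (fun x => toSign (h x)) / 4 ^ n) := by gcongr
    rw [abs_sub_comm]
    refine le_trans ?_ (le_abs_self _)
    linarith
  rw [card_univ] at h2
  have h2' : ((univ.filter fun ω : Fin N → Cube n × Cube n => TestAccepts k Rs τ h ω).card : ℝ) +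
    (univ.filter fun ω : Fin N → Cube n × Cube n => ¬ TestAccepts k Rs τ h ω).card =
      Fintype.card (Fin N → Cube n × Cube n) := by exact_mod_cast h2
  have h3' : ((univ.filter fun ω : Fin N → Cube n × Cube n =>
    ¬ TestAccepts k Rs τ h ω).card : ℝ) ≤ _ := (Nat.cast_le.2 h3).trans h1
  linarith

theorem testProb_le {n N k : ℕ} (hN : 0 < N) {Rs : Finset ℕ} {τ : ℕ → ℝ}
    (hτ : ∀ r ∈ Rs, 0 < τ r) {h : Cube n → Bool}
    (he : ∀ r ∈ Rs, (energy r k fun x => toSign (h x)) ≤ τ r / 2 * 4 ^ n) :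
    testProb N k Rs τ h ≤ ∑ r ∈ Rs, 4 * n ^ (2 * k) / (N * τ r ^ 2) := by
  classical
  have hcard : (0 : ℝ) < Fintype.card (Fin N → Cube n × Cube n) := by
    exact_mod_cast Fintype.card_pos
  rw [testProb, div_le_iff₀ hcard, sum_mul]
  have h1 : (univ.filter fun ω : Fin N → Cube n × Cube n => TestAccepts k Rs τ h ω) ⊆
      Rs.biUnion fun r => univ.filter fun ω : Fin N → Cube n × Cube n => N * (τ r / 2) ≤
      |∑ j, (pairStat r k h (ω j) : ℝ) -
        N * (energy r k (fun x => toSign (h x)) / 4 ^ n)| := by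
    intro ω hω
    obtain ⟨r, hr, h4⟩ := (mem_filter.1 hω).2
    simp only [mem_biUnion, mem_filter, mem_univ, true_and]
    refine ⟨r, hr, ?_⟩
    push_cast at h4
    have h5 : energy r k (fun x => toSign (h x)) / 4 ^ n ≤ τ r / 2 :=
      (div_le_iff₀ (by positivity)).2 (he r hr)
    have h6 : N * (energy r k (fun x => toSign (h x)) / 4 ^ n) ≤ (N : ℝ) * (τ r / 2) := by gcongr
    refine le_trans ?_ (le_abs_self _)
    linarith
  calc ((univ.filter fun ω : Fin N → Cube n × Cube n => TestAccepts k Rs τ h ω).card : ℝ)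
      ≤ ∑ r ∈ Rs, ((univ.filter fun ω : Fin N → Cube n × Cube n => N * (τ r / 2) ≤
      |∑ j, (pairStat r k h (ω j) : ℝ) -
        N * (energy r k (fun x => toSign (h x)) / 4 ^ n)|).card : ℝ) := by
        exact_mod_cast (card_le_card h1).trans card_biUnion_le
    _ ≤ _ := sum_le_sum fun r hr => by
        refine (card_pairStat_deviation_le hN r k h (half_pos (hτ r hr))).trans_eq ?_
        rw [mul_comm]
        congr 1
        have := (hτ r hr).ne'
        have hN' : (N : ℝ) ≠ 0 := by exact_mod_cast hN.ne'
        field_simp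
        ring

theorem testProb_le_one {n : ℕ} (N k : ℕ) (Rs : Finset ℕ) (τ : ℕ → ℝ) (h : Cube n → Bool) :
    testProb N k Rs τ h ≤ 1 := by
  classical
  refine div_le_one_of_le₀ ?_ (Nat.cast_nonneg _)
  exact_mod_cast card_le_univ _

theorem sum_testProb_le {n N k : ℕ} (hN : 0 < N) {Rs : Finset ℕ} {τ : ℕ → ℝ}
    (hτ : ∀ r ∈ Rs, 0 < τ r) :
    (∑ R : Cube n → Bool, testProb N k Rs τ R) / Fintype.card (Cube n → Bool) ≤
      ∑ r ∈ Rs, (2 * (n ^ k * n.choose r) / (τ r * 4 ^ n) +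
        4 * n ^ (2 * k) / (N * τ r ^ 2)) := by
  classical
  have hcard : (0 : ℝ) < Fintype.card (Cube n → Bool) := by exact_mod_cast Fintype.card_pos
  -- Markov in pointwise form: either all energies of `R` are small and Chebyshev applies, or some
  -- energy term on the right is already at least `1`.
  have h1 : ∀ R : Cube n → Bool, testProb N k Rs τ R ≤
      ∑ r ∈ Rs, (2 / (τ r * 4 ^ n) * (energy r k fun x => toSign (R x)) +
        4 * n ^ (2 * k) / (N * τ r ^ 2)) := by
    intro R
    rw [sum_add_distrib]
    have hnn : ∀ r ∈ Rs, 0 ≤ 2 / (τ r * 4 ^ n) * (energy r k fun x => toSign (R x)) :=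
      fun r hr => mul_nonneg (div_nonneg zero_le_two
        (mul_nonneg (hτ r hr).le (by positivity))) (energy_nonneg _ _ _)
    by_cases h : ∀ r ∈ Rs, (energy r k fun x => toSign (R x)) ≤ τ r / 2 * 4 ^ n
    · have := testProb_le hN hτ h
      have := sum_nonneg hnn
      linarith
    · push Not at h
      obtain ⟨r, hr, hlt⟩ := h
      have h2 := single_le_sum hnn hr
      have h3 : 1 ≤ 2 / (τ r * 4 ^ n) * (energy r k fun x => toSign (R x)) := by
        have := hτ r hr
        rw [div_mul_eq_mul_div, le_div_iff₀ (by positivity)]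
        linarith
      have h4 := testProb_le_one N k Rs τ R
      have h5 : 0 ≤ ∑ r ∈ Rs, (4 * (n : ℝ) ^ (2 * k) / (N * τ r ^ 2)) :=
        sum_nonneg fun r _ => by positivity
      linarith
  rw [div_le_iff₀ hcard]
  refine (sum_le_sum fun R _ => h1 R).trans ?_
  rw [sum_comm, sum_mul]
  refine sum_le_sum fun r hr => ?_
  have := hτ r hr
  rw [sum_add_distrib, ← mul_sum, sum_const, card_univ, nsmul_eq_mul, add_mul,
    mul_comm (_ / _) (Fintype.card _ : ℝ)]
  have h2 := mul_le_mul_of_nonneg_left (sum_energy_toSign_le (n := n) r k)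
    (show 0 ≤ 2 / (τ r * 4 ^ n) by positivity)
  have h3 : 2 / (τ r * 4 ^ n) * (Fintype.card (Cube n → Bool) * (n ^ k * n.choose r : ℝ)) =
    Fintype.card (Cube n → Bool) * (2 * (n ^ k * n.choose r) / (τ r * 4 ^ n)) := by ring
  rw [h3] at h2
  linarith

/-! ### Circuits that compute quantities with few values. -/

/-- The circuit with one more node. -/
def Circuit.snoc {ι : Type} (D : Circuit ι) (g : Gate ι) : Circuit ι := ⟨D.nodes ++ [g]⟩

/-- `D'` arises from `D` by adding nodes. -/
def Circuit.IsExtension {ι : Type} (D D' : Circuit ι) : Prop := D.nodes <+: D'.nodes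

theorem Circuit.isExtension_snoc {ι : Type} (D : Circuit ι) (g : Gate ι) :
    D.IsExtension (D.snoc g) := List.prefix_append _ _

theorem Circuit.size_snoc {ι : Type} (D : Circuit ι) (g : Gate ι) :
    (D.snoc g).size = D.size + 1 := by simp [Circuit.snoc, Circuit.size]

theorem Circuit.values_snoc {ι : Type} (D : Circuit ι) (g : Gate ι) (x : ι → Bool) :
    (D.snoc g).values x = D.values x ++ [g.eval x (D.values x)] := by
  simp [Circuit.snoc, Circuit.values]

theorem length_foldl_eval {ι : Type} (x : ι → Bool) (l : List (Gate ι)) (v : List Bool) :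
    (l.foldl (fun v g => v ++ [g.eval x v]) v).length = v.length + l.length := by
  induction l generalizing v with
  | nil => simp
  | cons g l ih => rw [List.foldl_cons, ih]; simp; omega

theorem Circuit.length_values {ι : Type} (D : Circuit ι) (x : ι → Bool) :
    (D.values x).length = D.size := by
  simp [Circuit.values, Circuit.size, length_foldl_eval]

theorem prefix_foldl_eval {ι : Type} (x : ι → Bool) (l : List (Gate ι)) (v : List Bool) :
    v <+: l.foldl (fun v g => v ++ [g.eval x v]) v := by
  induction l generalizing v with
  | nil => simp
  | cons g l ih => exact (List.prefix_append v _).trans (ih _)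

theorem Circuit.IsExtension.values_prefix {ι : Type} {D D' : Circuit ι} (h : D.IsExtension D')
    (x : ι → Bool) : D.values x <+: D'.values x := by
  obtain ⟨l, hl⟩ := h
  rw [Circuit.values, Circuit.values, ← hl, List.foldl_append]
  exact prefix_foldl_eval x l _

/-- Some node of the circuit computes `φ`. -/
def Circuit.Avail {ι : Type} (D : Circuit ι) (φ : (ι → Bool) → Bool) : Prop :=
  ∃ j < D.size, ∀ x, (D.values x).getD j false = φ x

theorem Circuit.Avail.mono {ι : Type} {D D' : Circuit ι} {φ : (ι → Bool) → Bool}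
    (h : D.Avail φ) (hD : D.IsExtension D') : D'.Avail φ := by
  obtain ⟨j, hj, hφ⟩ := h
  refine ⟨j, hj.trans_le hD.length_le, fun x => ?_⟩
  obtain ⟨l, hl⟩ := hD.values_prefix x
  rw [← hφ, ← hl, List.getD_append]
  rwa [D.length_values]

theorem Circuit.avail_snoc {ι : Type} (D : Circuit ι) (g : Gate ι) {φ : (ι → Bool) → Bool}
    (h : ∀ x, g.eval x (D.values x) = φ x) : (D.snoc g).Avail φ := by
  refine ⟨D.size, by simp [D.size_snoc], fun x => ?_⟩
  rw [D.values_snoc, ← D.length_values x, ← h]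
  simp

/-- From every circuit, with at most `c` additional nodes, one obtains a circuit which computes the
indicators of all values of `V`. -/
def CompCost {ι α : Type} [DecidableEq α] (V : (ι → Bool) → α) (c : ℕ) : Prop :=
  ∀ D : Circuit ι, ∃ D' : Circuit ι, D.IsExtension D' ∧ D'.size ≤ D.size + c ∧
    ∀ a, D'.Avail fun x => decide (V x = a)

theorem CompCost.mono {ι α : Type} [DecidableEq α] {V : (ι → Bool) → α} {c c' : ℕ}
    (h : CompCost V c) (hc : c ≤ c') : CompCost V c' := by
  intro D
  obtain ⟨D', h1, h2, h3⟩ := h D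
  exact ⟨D', h1, by omega, h3⟩

theorem compCost_input {ι : Type} (i : ι) : CompCost (fun x : ι → Bool => x i) 2 := by
  intro D
  have h1 : (D.snoc (.input i)).Avail fun x => x i := D.avail_snoc _ fun x => rfl
  obtain ⟨j, hj, hφ⟩ := id h1
  refine ⟨(D.snoc (.input i)).snoc (.not j), (D.isExtension_snoc _).trans
    (Circuit.isExtension_snoc _ _), by simp [Circuit.size_snoc], fun a => ?_⟩
  cases a with
  | true => simpa using h1.mono (Circuit.isExtension_snoc _ _)
  | false =>
    refine Circuit.avail_snoc _ _ fun x => ?_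
    have hb : ∀ b : Bool, (!b) = decide (b = false) := by decide
    simp only [Gate.eval, hφ]
    exact hb _

theorem compCost_const {ι α : Type} [DecidableEq α] (b : α) :
    CompCost (fun _ : ι → Bool => b) 2 := by
  intro D
  refine ⟨(D.snoc (.const true)).snoc (.const false), (D.isExtension_snoc _).trans
    (Circuit.isExtension_snoc _ _), by simp [Circuit.size_snoc], fun a => ?_⟩
  by_cases h : b = a
  · exact (D.avail_snoc (.const true) fun x => by simp [Gate.eval, h]).mono
      (Circuit.isExtension_snoc _ _)
  · exact Circuit.avail_snoc _ _ fun x => by simp [Gate.eval, h]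

/-- Each pair of values costs one AND node and one OR node, the latter updating only the indicator
of the output of that pair. The initial `false` node serves all outputs not yet reached, so the cost
is finite even for infinite `γ`. -/
theorem CompCost.comb {ι α β γ : Type} [DecidableEq α] [DecidableEq β] [DecidableEq γ]
    {V : (ι → Bool) → α} {W : (ι → Bool) → β} {c c' : ℕ} (hV : CompCost V c) (hW : CompCost W c')
    {RV : Finset α} {RW : Finset β} (hRV : ∀ x, V x ∈ RV) (hRW : ∀ x, W x ∈ RW)
    (F : α → β → γ) :
    CompCost (fun x => F (V x) (W x)) (c + c' + (1 + 2 * (RV.card * RW.card))) := by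
  intro D
  obtain ⟨D₁, hD₁, hs₁, ha₁⟩ := hV D
  obtain ⟨D₂, hD₂, hs₂, ha₂⟩ := hW D₁
  have key : ∀ P : Finset (α × β), ∃ D' : Circuit ι, D₂.IsExtension D' ∧
      D'.size ≤ D₂.size + (1 + 2 * P.card) ∧ ∀ z, D'.Avail fun x =>
        decide (∃ p ∈ P, F p.1 p.2 = z ∧ V x = p.1 ∧ W x = p.2) := by
    intro P
    induction P using Finset.induction_on with
    | empty =>
      exact ⟨D₂.snoc (.const false), D₂.isExtension_snoc _, by simp [Circuit.size_snoc],
        fun z => D₂.avail_snoc _ fun x => by simp [Gate.eval]⟩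
    | insert p P hp ih =>
      obtain ⟨D₃, hD₃, hs₃, ha₃⟩ := ih
      obtain ⟨i, -, hi⟩ := ((ha₁ p.1).mono hD₂).mono hD₃
      obtain ⟨j, -, hj⟩ := (ha₂ p.2).mono hD₃
      have h4 : (D₃.snoc (.and i j)).Avail fun x => decide (V x = p.1) && decide (W x = p.2) :=
        D₃.avail_snoc _ fun x => by simp only [Gate.eval, hi, hj]
      obtain ⟨l, -, hl⟩ := id h4
      obtain ⟨k, -, hk⟩ := (ha₃ (F p.1 p.2)).mono (D₃.isExtension_snoc (.and i j))
      refine ⟨(D₃.snoc (.and i j)).snoc (.or l k), hD₃.trans ((D₃.isExtension_snoc _).trans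
        (Circuit.isExtension_snoc _ _)), ?_, fun z => ?_⟩
      · rw [card_insert_of_notMem hp]
        simp only [Circuit.size_snoc]
        omega
      · by_cases hz : F p.1 p.2 = z
        · subst hz
          refine Circuit.avail_snoc _ _ fun x => ?_
          simp only [Gate.eval, hl, hk, exists_mem_insert, true_and]
          rw [Bool.decide_or, Bool.decide_and]
        · have := ((ha₃ z).mono (D₃.isExtension_snoc (.and i j))).mono
            (Circuit.isExtension_snoc _ (.or l k))
          simpa only [exists_mem_insert, hz, false_and, false_or] using this
  obtain ⟨D', hD', hs', ha'⟩ := key (RV ×ˢ RW)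
  rw [card_product] at hs'
  refine ⟨D', hD₁.trans (hD₂.trans hD'), by omega, fun z => ?_⟩
  convert ha' z using 2 with x
  refine decide_eq_decide.2 ⟨fun h => ⟨(V x, W x), mem_product.2 ⟨hRV x, hRW x⟩, h, rfl, rfl⟩, ?_⟩
  rintro ⟨p, -, h, h1, h2⟩
  show F (V x) (W x) = z
  rw [h1, h2, h]

theorem CompCost.map {ι α γ : Type} [DecidableEq α] [DecidableEq γ]
    {V : (ι → Bool) → α} {c : ℕ} (hV : CompCost V c) {RV : Finset α} (hRV : ∀ x, V x ∈ RV)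
    (F : α → γ) : CompCost (fun x => F (V x)) (c + (3 + 2 * RV.card)) :=
  (hV.comb (compCost_const ()) hRV (RW := {()}) (fun _ => by simp) fun a _ => F a).mono
    (by simp; omega)

theorem compCost_sum {ι : Type} {N c K : ℕ} {V : Fin N → (ι → Bool) → ℤ}
    (hV : ∀ j, CompCost (V j) c) (hK : ∀ j x, |V j x| ≤ K) :
    CompCost (fun x => ∑ j, V j x)
      (2 + N * (c + (1 + 2 * ((2 * (N * K) + 1) * (2 * K + 1))))) := by
  have hsum : ∀ M (V : Fin M → (ι → Bool) → ℤ), (∀ j x, |V j x| ≤ K) → ∀ x,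
      |∑ j, V j x| ≤ (M * K : ℕ) := by
    intro M V hK x
    refine (abs_sum_le_sum_abs _ _).trans ?_
    have := sum_le_card_nsmul univ _ _ fun j _ => hK j x
    simpa using this
  -- All partial sums are confined to the same range `[-NK, NK]`, so every addition has the same
  -- cost bound.
  suffices h : ∀ M ≤ N, ∀ V : Fin M → (ι → Bool) → ℤ, (∀ j, CompCost (V j) c) →
      (∀ j x, |V j x| ≤ K) → CompCost (fun x => ∑ j, V j x)
        (2 + M * (c + (1 + 2 * ((2 * (N * K) + 1) * (2 * K + 1))))) from h N le_rfl V hV hK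
  intro M
  induction M with
  | zero => intro _ V _ _; simpa using compCost_const 0
  | succ M ih =>
    intro hM V hV hK
    simp only [Fin.sum_univ_castSucc]
    refine ((ih (by omega) (fun j => V j.castSucc) (fun j => hV _) fun j => hK _).comb
      (hV (Fin.last M)) (RV := Icc (-((N * K : ℕ) : ℤ)) (N * K : ℕ))
      (RW := Icc (-(K : ℤ)) K) (fun x => ?_) (fun x => ?_) fun a b => a + b).mono ?_
    · have h1 := hsum M (fun j => V j.castSucc) (fun j => hK _) x
      have h2 : ((M * K : ℕ) : ℤ) ≤ (N * K : ℕ) := by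
        exact_mod_cast Nat.mul_le_mul_right K (by omega)
      exact Finset.mem_Icc.2 (abs_le.1 (h1.trans h2))
    · exact Finset.mem_Icc.2 (abs_le.1 (hK _ x))
    · have h1 : (Icc (-((N * K : ℕ) : ℤ)) (N * K : ℕ)).card = 2 * (N * K) + 1 := by
        rw [Int.card_Icc]; omega
      have h2 : (Icc (-(K : ℤ)) K).card = 2 * K + 1 := by rw [Int.card_Icc]; omega
      rw [h1, h2]
      apply le_of_eq
      ring

theorem compCost_exists {ι : Type} {c : ℕ} (Rs : Finset ℕ) {T : ℕ → (ι → Bool) → Bool}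
    (hT : ∀ r ∈ Rs, CompCost (T r) c) :
    CompCost (fun x => decide (∃ r ∈ Rs, T r x = true)) (2 + Rs.card * (c + 9)) := by
  induction Rs using Finset.induction_on with
  | empty => simpa using compCost_const false
  | insert r Rs hr ih =>
    rw [card_insert_of_notMem hr]
    have := ((hT r (mem_insert_self _ _)).comb
      (ih fun r hr => hT r (mem_insert_of_mem hr)) (RV := univ) (RW := univ)
      (fun _ => mem_univ _) (fun _ => mem_univ _) fun a b => a || b).mono
      (c' := 2 + (Rs.card + 1) * (c + 9)) (by
        simp only [card_univ, Fintype.card_bool]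
        apply le_of_eq
        ring)
    convert this using 2 with x
    simp only [exists_mem_insert]
    rw [Bool.decide_or, Bool.decide_eq_true]

theorem CompCost.exists_circuit {ι : Type} {V : (ι → Bool) → Bool} {c : ℕ} (h : CompCost V c) :
    ∃ D : Circuit ι, D.size ≤ c + 1 ∧ ∀ x, D.eval x = V x := by
  obtain ⟨D, -, hs, ha⟩ := h ⟨[]⟩
  obtain ⟨j, -, hj⟩ := ha true
  -- The output must be the last node, so the node `j` is repeated there.
  refine ⟨D.snoc (.or j j), ?_, fun x => ?_⟩
  · rw [Circuit.size_snoc]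
    simpa [Circuit.size] using hs
  · have hv : (D.snoc (.or j j)).values x = D.values x ++ [V x] := by
      rw [Circuit.values_snoc]
      simp only [Gate.eval, hj]
      simp
    rw [Circuit.eval, hv]
    simp [List.getLastD_eq_getLast?]

/-- The `j`-th point encoded in the input of a distinguisher. -/
def pointOf {n m : ℕ} (j : Fin m) (u : Fin m × Option (Fin n) → Bool) : Cube n :=
  fun i => u (j, some i)

/-- The number of nodes that suffice to count over `n` positions. -/
def countCost (n : ℕ) : ℕ := 2 + n * (13 + (1 + 2 * ((2 * (n * 1) + 1) * (2 * 1 + 1))))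

theorem compCost_wt {n m : ℕ} (j : Fin m) :
    CompCost (fun u : Fin m × Option (Fin n) → Bool => (wt (pointOf j u) : ℤ)) (countCost n) := by
  have h := compCost_sum (N := n) (K := 1) (c := 13)
    (V := fun i (u : Fin m × Option (Fin n) → Bool) => if u (j, some i) = true then 1 else 0)
    (fun i => ((compCost_input (j, some i)).map (RV := univ) (fun _ => mem_univ _)
      fun b => if b = true then (1 : ℤ) else 0).mono (by simp))
    (fun i u => by split_ifs <;> simp)
  convert h using 2 with u
  · rw [sum_boole]
    rfl
  · rfl

theorem compCost_common {n m : ℕ} (j l : Fin m) :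
    CompCost (fun u : Fin m × Option (Fin n) → Bool =>
      (common (pointOf j u) (pointOf l u) : ℤ)) (countCost n) := by
  have h := compCost_sum (N := n) (K := 1) (c := 13)
    (V := fun i (u : Fin m × Option (Fin n) → Bool) =>
      if u (j, some i) = true ∧ u (l, some i) = true then 1 else 0)
    -- The constant `13` of `countCost` is `2 + 2 + (1 + 2 · 4)`: two input bits and four pairs of
    -- values.
    (fun i => ((compCost_input (j, some i)).comb (compCost_input (l, some i)) (RV := univ)
      (RW := univ) (fun _ => mem_univ _) (fun _ => mem_univ _)
      fun b c => if b = true ∧ c = true then (1 : ℤ) else 0).mono (by simp))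
    (fun i u => by split_ifs <;> simp)
  convert h using 2 with u
  · rw [sum_boole]
    rfl
  · rfl

theorem wt_le {n : ℕ} (x : Cube n) : wt x ≤ n := (card_le_univ _).trans_eq (Fintype.card_fin n)

theorem common_le {n : ℕ} (x y : Cube n) : common x y ≤ n :=
  (card_le_univ _).trans_eq (Fintype.card_fin n)

/-- The contribution of the examples `j` and `l` to the test, read off the input. -/
def inputStat {n m : ℕ} (r k : ℕ) (j l : Fin m) (u : Fin m × Option (Fin n) → Bool) : ℤ :=
  (if (decide (((wt (pointOf j u) : ℕ) : ℤ) = r ∧ ((wt (pointOf l u) : ℕ) : ℤ) = r)) = true then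
    (if (u (j, none) == u (l, none)) = true then 1 else -1) else 0) *
      ((((common (pointOf j u) (pointOf l u) : ℕ) : ℤ).toNat.choose k : ℕ) : ℤ)

theorem inputStat_exampleBits {n m : ℕ} (r k : ℕ) (j l : Fin m) (h : Cube n → Bool)
    (x : Fin m → Cube n) : inputStat r k j l (exampleBits h x) = pairStat r k h (x j, x l) := by
  have hp : ∀ j, pointOf j (exampleBits h x) = x j := fun j => rfl
  have hl : ∀ j, exampleBits h x (j, none) = h (x j) := fun j => rfl
  simp only [inputStat, pairStat, hp, hl, Nat.cast_inj, decide_eq_true_eq, beq_iff_eq,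
    Int.toNat_natCast, ite_mul, zero_mul]

theorem abs_inputStat_le {n m : ℕ} (r k : ℕ) (j l : Fin m) (u : Fin m × Option (Fin n) → Bool) :
    |inputStat r k j l u| ≤ (n ^ k : ℕ) := by
  have h1 : ((common (pointOf j u) (pointOf l u)).choose k : ℤ) ≤ (n ^ k : ℕ) := by
    exact_mod_cast (Nat.choose_le_pow _ _).trans (Nat.pow_le_pow_left (common_le _ _) k)
  unfold inputStat
  rw [Int.toNat_natCast]
  split_ifs
  · simpa using h1
  · simpa using h1
  · simp

theorem compCost_inputStat {n m : ℕ} (hn : 1 ≤ n) (r k : ℕ) (j l : Fin m) :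
    CompCost (inputStat (n := n) r k j l) (200 * n ^ 2) := by
  have hw : ∀ (j : Fin m) (u : Fin m × Option (Fin n) → Bool),
      ((wt (pointOf j u) : ℕ) : ℤ) ∈ Icc (0 : ℤ) n := fun j u =>
    Finset.mem_Icc.2 ⟨Nat.cast_nonneg _, by exact_mod_cast wt_le _⟩
  have hflag := (compCost_wt (n := n) j).comb (compCost_wt l) (hw j) (hw l)
    fun a b => decide (a = r ∧ b = r)
  have hlabel := (compCost_input ((j, none) : Fin m × Option (Fin n))).comb
    (compCost_input (l, none)) (RV := univ) (RW := univ) (fun _ => mem_univ _)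
    (fun _ => mem_univ _) fun a b => a == b
  have hsign := hflag.comb hlabel (RV := univ) (RW := univ) (fun _ => mem_univ _)
    (fun _ => mem_univ _) fun a b => if a = true then (if b = true then (1 : ℤ) else -1) else 0
  have hall := hsign.comb (compCost_common (n := n) j l) (RV := Icc (-1) 1) (RW := Icc 0 (n : ℤ))
    (fun u => by split_ifs <;> simp)
    (fun u => Finset.mem_Icc.2 ⟨Nat.cast_nonneg _, by exact_mod_cast common_le _ _⟩)
    fun a b => a * ((b.toNat.choose k : ℕ) : ℤ)
  refine CompCost.mono (c := _) hall ?_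
  have h1 : (Icc (0 : ℤ) n).card = n + 1 := by rw [Int.card_Icc]; omega
  have h2 : (Icc (-1 : ℤ) 1).card = 3 := by rw [Int.card_Icc]; rfl
  rw [h1, h2]
  simp only [card_univ, Fintype.card_bool, countCost]
  nlinarith [Nat.mul_le_mul hn hn]

open Classical in
theorem compCost_test {n N k : ℕ} (hn : 1 ≤ n) (hN : n ^ 2 ≤ N) {Rs : Finset ℕ}
    (hRs : Rs ⊆ range (n + 1)) (τ : ℕ → ℝ) :
    CompCost (fun u : Fin (N + N) × Option (Fin n) → Bool => decide (∃ r ∈ Rs,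
      decide (N * τ r ≤ ((∑ j : Fin N, inputStat r k (Fin.castAdd N j) (Fin.natAdd N j) u : ℤ) : ℝ))
        = true)) (499 * (n * N ^ 2 * (n ^ k) ^ 2)) := by
  have hT : ∀ r ∈ Rs, CompCost (fun u : Fin (N + N) × Option (Fin n) → Bool =>
      decide (N * τ r ≤
        ((∑ j : Fin N, inputStat r k (Fin.castAdd N j) (Fin.natAdd N j) u : ℤ) : ℝ)))
      (2 + N * (200 * n ^ 2 + (1 + 2 * ((2 * (N * n ^ k) + 1) * (2 * n ^ k + 1)))) +
        (3 + 2 * (2 * (N * n ^ k) + 1))) := by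
    intro r _
    have hs := compCost_sum (N := N) (K := n ^ k)
      (V := fun j (u : Fin (N + N) × Option (Fin n) → Bool) =>
        inputStat r k (Fin.castAdd N j) (Fin.natAdd N j) u)
      (fun j => compCost_inputStat hn r k _ _) fun j u => abs_inputStat_le r k _ _ u
    have hm := hs.map (RV := Icc (-((N * n ^ k : ℕ) : ℤ)) (N * n ^ k : ℕ)) (fun u => by
      refine Finset.mem_Icc.2 (abs_le.1 ((abs_sum_le_sum_abs _ _).trans ?_))
      have := sum_le_card_nsmul univ _ _ fun (j : Fin N) _ =>
        abs_inputStat_le r k (Fin.castAdd N j) (Fin.natAdd N j) u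
      simpa using this) fun z : ℤ => decide (N * τ r ≤ (z : ℝ))
    have h1 : (Icc (-((N * n ^ k : ℕ) : ℤ)) (N * n ^ k : ℕ)).card = 2 * (N * n ^ k) + 1 := by
      rw [Int.card_Icc]; omega
    rw [h1] at hm
    exact hm
  refine (compCost_exists Rs hT).mono ?_
  have hcard : Rs.card ≤ 2 * n := by
    have := card_le_card hRs
    rw [card_range] at this
    omega
  have hK : 1 ≤ n ^ k := Nat.one_le_pow _ _ hn
  generalize n ^ k = K at hK
  have hN1 : 1 ≤ N := (Nat.one_le_pow _ _ hn).trans hN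
  have hNK : 1 ≤ N * K := Nat.mul_le_mul hN1 hK
  have hNN : N ≤ N ^ 2 * K ^ 2 := by
    calc N = N * 1 * 1 := by ring
      _ ≤ N * N * K ^ 2 := by gcongr; exact Nat.one_le_pow _ _ hK
      _ = _ := by ring
  have hNK2 : N * K ≤ N ^ 2 * K ^ 2 := by
    calc N * K = N * K * 1 := by ring
      _ ≤ N * K * (N * K) := by gcongr
      _ = _ := by ring
  have h1 : (2 * (N * K) + 1) * (2 * K + 1) ≤ (3 * (N * K)) * (3 * K) := by gcongr <;> omega
  have h2 : N * n ^ 2 ≤ N ^ 2 * K ^ 2 := by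
    calc N * n ^ 2 ≤ N * N * 1 := by rw [mul_one]; gcongr
      _ ≤ N * N * K ^ 2 := by gcongr; exact Nat.one_le_pow _ _ hK
      _ = _ := by ring
  have h3 : 2 + N * (200 * n ^ 2 + (1 + 2 * ((2 * (N * K) + 1) * (2 * K + 1)))) +
        (3 + 2 * (2 * (N * K) + 1)) + 9 ≤ 245 * (N ^ 2 * K ^ 2) := by
    have h4 : N * ((2 * (N * K) + 1) * (2 * K + 1)) ≤ 9 * (N ^ 2 * K ^ 2) := by
      calc N * ((2 * (N * K) + 1) * (2 * K + 1)) ≤ N * ((3 * (N * K)) * (3 * K)) := by gcongr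
        _ = _ := by ring
    have h5 : 1 ≤ N ^ 2 * K ^ 2 := hNK.trans hNK2
    have h6 : N * (200 * n ^ 2 + (1 + 2 * ((2 * (N * K) + 1) * (2 * K + 1)))) =
      200 * (N * n ^ 2) + N + 2 * (N * ((2 * (N * K) + 1) * (2 * K + 1))) := by ring
    omega
  calc _ ≤ 2 + 2 * n * (245 * (N ^ 2 * K ^ 2)) := by gcongr
    _ ≤ 2 * (n * (N ^ 2 * K ^ 2)) + 2 * n * (245 * (N ^ 2 * K ^ 2)) := by
        gcongr
        have := Nat.mul_le_mul hn (hNK.trans hNK2)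
        omega
    _ ≤ 499 * (n * N ^ 2 * K ^ 2) := by
        have : n * N ^ 2 * K ^ 2 = n * (N ^ 2 * K ^ 2) := by ring
        rw [this]
        nlinarith

/-- A sequence of `N + N` samples is a sequence of `N` pairs of samples. -/
def pairSamples (n N : ℕ) : (Fin (N + N) → Cube n) ≃ (Fin N → Cube n × Cube n) where
  toFun x j := (x (Fin.castAdd N j), x (Fin.natAdd N j))
  invFun ω := Fin.append (fun j => (ω j).1) fun j => (ω j).2
  left_inv x := by
    funext j
    refine Fin.addCases (fun j => ?_) (fun j => ?_) j
    · simp only [Fin.append_left]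
    · simp only [Fin.append_right]
  right_inv ω := by
    funext j
    simp only [Fin.append_left, Fin.append_right]

/-- The test is carried out by a small circuit. -/
theorem exists_distinguisher {n N k : ℕ} (hn : 1 ≤ n) (hN : n ^ 2 ≤ N) {Rs : Finset ℕ}
    (hRs : Rs ⊆ range (n + 1)) (τ : ℕ → ℝ) :
    ∃ D : Distinguisher n (N + N), D.size ≤ 500 * (n * N ^ 2 * (n ^ k) ^ 2) ∧
      ∀ h, acceptProb D h = testProb N k Rs τ h := by
  classical
  obtain ⟨D, hs, hD⟩ := (compCost_test (k := k) hn hN hRs τ).exists_circuit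
  refine ⟨D, hs.trans ?_, fun h => ?_⟩
  · have h1 : 0 < n * N ^ 2 * (n ^ k) ^ 2 := by
      have : 0 < n := hn
      have : 0 < N := (Nat.pow_pos this).trans_le hN
      positivity
    omega
  · rw [acceptProb, testProb, Fintype.card_congr (pairSamples n N)]
    congr 2
    refine card_equiv (pairSamples n N) fun x => ?_
    simp only [mem_filter, mem_univ, true_and, hD, decide_eq_true_eq, inputStat_exampleBits]
    rfl

/-! ### Size of the slices near the middle. -/

theorem choose_add_le_mul_pow {n r : ℕ} (hr : r ≤ n) (j : ℕ) :
    (n.choose (r + j) : ℝ) ≤ n.choose r * (((n : ℝ) - r) / (r + 1)) ^ j := by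
  have hnr : (0 : ℝ) ≤ (n : ℝ) - r := by
    have : (r : ℝ) ≤ n := by exact_mod_cast hr
    linarith
  induction j with
  | zero => simp
  | succ j ih =>
    have h1 := Nat.choose_succ_right_eq n (r + j)
    have h2 : (n.choose (r + j + 1) : ℝ) * (r + j + 1) ≤ n.choose (r + j) * ((n : ℝ) - r) := by
      have h3 : ((n - (r + j) : ℕ) : ℝ) ≤ (n : ℝ) - r := by
        rw [← Nat.cast_sub hr]
        exact_mod_cast (by omega : n - (r + j) ≤ n - r)
      have h4 : (n.choose (r + j + 1) : ℝ) * (r + j + 1) =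
          n.choose (r + j) * ((n - (r + j) : ℕ) : ℝ) := by exact_mod_cast h1
      rw [h4]
      gcongr
    have h5 : (n.choose (r + j + 1) : ℝ) ≤ n.choose (r + j) * (((n : ℝ) - r) / (r + 1)) := by
      rw [← mul_div_assoc, le_div_iff₀ (by positivity)]
      refine le_trans ?_ h2
      gcongr
      linarith [(Nat.cast_nonneg j : (0 : ℝ) ≤ j)]
    rw [← add_assoc, pow_succ, ← mul_assoc]
    exact h5.trans (mul_le_mul_of_nonneg_right ih (by positivity))

/-- The slope `8/3` is that of the chord up to `u = 1/4`, and `8/3 < 4 ln 2`. -/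
theorem one_add_div_one_sub_le {u : ℝ} (h0 : 0 ≤ u) (h1 : u ≤ 1 / 4) :
    (1 + u) / (1 - u) ≤ (2 : ℝ) ^ (4 * u) := by
  have h2 : (1 + u) / (1 - u) ≤ 1 + 8 / 3 * u := by
    rw [div_le_iff₀ (by linarith)]
    nlinarith
  refine h2.trans ((by linarith [Real.add_one_le_exp (8 / 3 * u)] :
    1 + 8 / 3 * u ≤ Real.exp (8 / 3 * u)).trans ?_)
  rw [Real.rpow_def_of_pos two_pos]
  refine Real.exp_le_exp.2 ?_
  nlinarith [Real.log_two_gt_d9]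

theorem two_pow_le_choose_half {n r : ℕ} {t : ℝ} (hn : 1 ≤ n) (hr : 2 * r ≤ n)
    (ht : t ≤ n / 4) (hrt : (n : ℝ) / 2 - t / 2 ≤ r) :
    (2 : ℝ) ^ n ≤ (n + 1) * (n.choose r * (2 : ℝ) ^ (2 * t ^ 2 / n)) := by
  have hn0 : (0 : ℝ) < n := by exact_mod_cast hn
  have hr' : 2 * (r : ℝ) ≤ n := by exact_mod_cast hr
  have hmid : (2 : ℝ) ^ n ≤ (n + 1) * n.choose (n / 2) := by
    have h : 2 ^ n ≤ (n + 1) * n.choose (n / 2) := by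
      rw [← Nat.sum_range_choose]
      have := sum_le_card_nsmul (range (n + 1)) (fun i => n.choose i) _
        fun i _ => Nat.choose_le_middle i n
      simpa using this
    exact_mod_cast h
  refine hmid.trans ?_
  gcongr
  obtain ⟨j, hj⟩ : ∃ j, n / 2 = r + j := ⟨n / 2 - r, by omega⟩
  rw [hj]
  refine (choose_add_le_mul_pow (by omega) j).trans ?_
  gcongr
  have hj' : (j : ℝ) ≤ n / 2 - r := by
    have : 2 * (r + j) ≤ n := by omega
    have : 2 * ((r : ℝ) + j) ≤ n := by exact_mod_cast this
    linarith
  -- With `u` the relative distance from the middle, each of the `j ≤ un/2` steps costs at most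
  -- `(1+u)/(1-u) ≤ 2^{4u}`, in total `2^{2u²n} ≤ 2^{2t²/n}`.
  set u : ℝ := (n - 2 * r) / n with hu
  have hun : u * n = n - 2 * r := div_mul_cancel₀ _ hn0.ne'
  have hu0 : 0 ≤ u := div_nonneg (by linarith) hn0.le
  have hut : u * n ≤ t := by linarith
  have hu1 : u ≤ 1 / 4 := by
    rw [hu, div_le_iff₀ hn0]
    linarith
  have h1 : ((n : ℝ) - r) / (r + 1) ≤ (1 + u) / (1 - u) := by
    rw [div_le_div_iff₀ (by positivity) (by linarith)]
    have h2 : (r : ℝ) = n * (1 - u) / 2 := by linarith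
    rw [h2]
    nlinarith
  have h3 : 0 ≤ ((n : ℝ) - r) / (r + 1) := div_nonneg (by linarith) (by positivity)
  calc (((n : ℝ) - r) / (r + 1)) ^ j ≤ ((2 : ℝ) ^ (4 * u)) ^ j :=
        pow_le_pow_left₀ h3 (h1.trans (one_add_div_one_sub_le hu0 hu1)) j
    _ = (2 : ℝ) ^ (4 * u * j) := by rw [← Real.rpow_natCast, ← Real.rpow_mul zero_le_two]
    _ ≤ (2 : ℝ) ^ (2 * t ^ 2 / n) := by
        refine Real.rpow_le_rpow_of_exponent_le one_le_two ?_
        rw [le_div_iff₀ hn0]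
        have h4 : 4 * u * j ≤ 2 * u * (u * n) := by nlinarith
        nlinarith [mul_nonneg hu0 hn0.le]

/-- The slices of weight close to `n / 2` contain a not too small part of the cube. -/
theorem two_pow_le_choose {n r : ℕ} {t : ℝ} (hn : 1 ≤ n) (hrn : r ≤ n) (ht : t ≤ n / 4)
    (h1 : (n : ℝ) / 2 - t / 2 ≤ r) (h2 : (r : ℝ) ≤ (n : ℝ) / 2 + t / 2) :
    (2 : ℝ) ^ n ≤ (n + 1) * (n.choose r * (2 : ℝ) ^ (2 * t ^ 2 / n)) := by
  rcases le_total (2 * r) n with h | h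
  · exact two_pow_le_choose_half hn h ht h1
  · rw [← Nat.choose_symm hrn]
    refine two_pow_le_choose_half hn (by omega) ht ?_
    rw [Nat.cast_sub hrn]
    linarith

/-! ### Choice of parameters and conclusion. -/

/-- A distinguisher that accepts all functions of a family with high probability, and random
functions with low probability, has a large advantage. -/
theorem lt_advantage {n m k : ℕ} {D : Distinguisher n m} {S : PMF (Cube k)}
    {F : Cube k → Cube n → Bool} {a b δ : ℝ} (hF : ∀ s ∈ S.support, 1 - a ≤ acceptProb D (F s))
    (hR : acceptProbRandom D ≤ b) (hδ : δ < 1 - a - b) : δ < advantage D S F := by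
  have hsum : ∑ s, (S s).toReal = 1 := by
    have h1 := S.tsum_coe
    rw [tsum_fintype] at h1
    rw [← ENNReal.toReal_sum fun s _ => S.apply_ne_top s, h1, ENNReal.toReal_one]
  have h : 1 - a ≤ acceptProbFamily D S F := by
    have h1 : 1 - a = ∑ s, (S s).toReal * (1 - a) := by rw [← sum_mul, hsum, one_mul]
    rw [acceptProbFamily, h1]
    refine sum_le_sum fun s _ => ?_
    by_cases hs : s ∈ S.support
    · exact mul_le_mul_of_nonneg_left (hF s hs) ENNReal.toReal_nonneg
    · simp [(S.apply_eq_zero_iff s).2 hs]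
  exact hδ.trans_le ((by linarith : 1 - a - b ≤ _).trans (le_abs_self _))

/-- The slices on which the test is carried out. -/
def nearSlices (n : ℕ) (t : ℝ) : Finset ℕ :=
  (range (n + 1)).filter fun r => (n : ℝ) / 2 - t / 2 ≤ r ∧ (r : ℝ) ≤ (n : ℝ) / 2 + t / 2

theorem mem_nearSlices {n r : ℕ} {t : ℝ} : r ∈ nearSlices n t ↔
    r ≤ n ∧ (n : ℝ) / 2 - t / 2 ≤ r ∧ (r : ℝ) ≤ (n : ℝ) / 2 + t / 2 := by
  simp [nearSlices]

/-- The threshold of the test on the slice of weight `r`. -/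
def threshold (n k r : ℕ) : ℝ := (n.choose r : ℝ) ^ 2 / (4 * n ^ (2 * k) * 4 ^ n)

theorem exists_distinguisher_of_bounds {n : ℕ} {t d δ : ℝ} (hn : 2 ≤ n) (ht : t ≤ n / 4)
    (hd : 1 ≤ d) (hdn : d * Real.logb 2 n ≤ n / 100) (hδ : δ < 1 - 136 / n) :
    ∃ (m : ℕ) (D : Distinguisher n m),
      (m : ℝ) ≤ (2 : ℝ) ^ (50 * (d * Real.logb 2 n + t ^ 2 / n)) ∧
      (D.size : ℝ) ≤ (2 : ℝ) ^ (50 * (d * Real.logb 2 n + t ^ 2 / n)) ∧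
      ∀ (k : ℕ) (S : PMF (Cube k)) (F : Cube k → Cube n → Bool),
        (∀ s ∈ S.support, IsConcentrated t d (1 / 2) (F s)) → δ < advantage D S F := by
  -- For `t < 0` no weight is admissible, so no function is concentrated; since a distribution has
  -- nonempty support, the hypothesis on the family is contradictory.
  rcases lt_or_ge t 0 with ht0 | ht0
  · refine ⟨0, ⟨[]⟩, by simpa using by positivity, by simp [Circuit.size]; positivity,
      fun k S F h => ?_⟩
    obtain ⟨s, hs⟩ := S.support_nonempty
    obtain ⟨r, -, h1, h2, -⟩ := h s hs
    linarith
  have hn2 : (2 : ℝ) ≤ n := by exact_mod_cast hn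
  have hn0 : (0 : ℝ) < n := by linarith
  have hlog : 1 ≤ Real.logb 2 n := by
    rw [Real.le_logb_iff_rpow_le one_lt_two hn0]
    simpa using hn2
  set k := ⌊d⌋₊ with hk
  have hkd : (k : ℝ) ≤ d := Nat.floor_le (by linarith)
  have hdn' : d ≤ n / 100 := le_trans (by nlinarith) hdn
  set Y : ℝ := (2 : ℝ) ^ (d * Real.logb 2 n) with hY
  set Z : ℝ := (2 : ℝ) ^ (t ^ 2 / n) with hZ
  have hYn : Y = (n : ℝ) ^ d := by
    rw [hY, mul_comm, Real.rpow_mul zero_le_two, Real.rpow_logb two_pos (by norm_num) hn0]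
  have hnY : (n : ℝ) ≤ Y := by
    rw [hYn]
    simpa using Real.rpow_le_rpow_of_exponent_le (by linarith : (1 : ℝ) ≤ n) hd
  have hkY : (n : ℝ) ^ k ≤ Y := by
    rw [hYn, ← Real.rpow_natCast]
    exact Real.rpow_le_rpow_of_exponent_le (by linarith) hkd
  have hY2 : 2 ≤ Y := hn2.trans hnY
  have hZ1 : 1 ≤ Z := Real.one_le_rpow one_le_two (by positivity)
  have hnY2 : (n : ℝ) + 1 ≤ Y ^ 2 := by nlinarith
  have hX : (2 : ℝ) ^ (d * Real.logb 2 n + t ^ 2 / n) = Y * Z := Real.rpow_add two_pos _ _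
  set X : ℝ := Y * Z with hXdef
  have hYX : Y ≤ X := le_mul_of_one_le_right (by linarith) hZ1
  have hX2 : 2 ≤ X := hY2.trans hYX
  have hX50 : (2 : ℝ) ^ (50 * (d * Real.logb 2 n + t ^ 2 / n)) = X ^ 50 := by
    rw [mul_comm, Real.rpow_mul zero_le_two, hX]
    exact_mod_cast Real.rpow_natCast X 50
  have hpow : ∀ (a : ℝ) (m : ℕ), ((2 : ℝ) ^ a) ^ m = (2 : ℝ) ^ (a * m) := fun a m => by
    rw [← Real.rpow_natCast, ← Real.rpow_mul zero_le_two]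
  have hYZ : Y ^ 8 * Z ^ 2 ≤ 2 ^ n := by
    rw [hY, hZ, hpow, hpow, ← Real.rpow_natCast 2 n, ← Real.rpow_add two_pos]
    refine Real.rpow_le_rpow_of_exponent_le one_le_two ?_
    have h1 : t ^ 2 / n ≤ n / 16 := by
      rw [div_le_iff₀ hn0]
      nlinarith
    push_cast
    linarith
  -- By `hτ` below, `1/τ ≤ 4 Y^6 Z^4`. The Chebyshev error `n^{2k} / (N τ²)` is then at most `16
  -- Y^14 Z^8 / N`, and the exponent `18` makes it at most `16 / Y^4`.
  set N : ℕ := ⌈X ^ 18⌉₊ with hN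
  have hXN : X ^ 18 ≤ N := Nat.le_ceil _
  have hX18 : 1 ≤ X ^ 18 := one_le_pow₀ (by linarith)
  have hNX : (N : ℝ) ≤ 2 * X ^ 18 := by
    have := Nat.ceil_lt_add_one (show 0 ≤ X ^ 18 by positivity)
    linarith
  have hnN : n ^ 2 ≤ N := by
    have h1 : (n : ℝ) ^ 2 ≤ N := by
      calc (n : ℝ) ^ 2 ≤ X ^ 2 := by gcongr; linarith
        _ ≤ X ^ 18 := pow_le_pow_right₀ (by linarith) (by norm_num)
        _ ≤ N := hXN
    exact_mod_cast h1
  have hN0 : 0 < N := (Nat.pow_pos (by omega)).trans_le hnN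
  have hN0' : (0 : ℝ) < N := by exact_mod_cast hN0
  obtain ⟨D, hsize, hD⟩ := exists_distinguisher (k := k) (by omega : 1 ≤ n) hnN
    (Rs := nearSlices n t) (filter_subset _ _) (threshold n k)
  have hchoose : ∀ r ∈ nearSlices n t, (2 : ℝ) ^ n ≤ Y ^ 2 * Z ^ 2 * n.choose r := by
    intro r hr
    obtain ⟨hrn, h1, h2⟩ := mem_nearSlices.1 hr
    have h3 := two_pow_le_choose (by omega) hrn ht h1 h2
    have h4 : (2 : ℝ) ^ (2 * t ^ 2 / n) = Z ^ 2 := by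
      rw [hZ, hpow]
      congr 1
      push_cast
      ring
    rw [h4] at h3
    calc (2 : ℝ) ^ n ≤ (n + 1) * (n.choose r * Z ^ 2) := h3
      _ ≤ Y ^ 2 * (n.choose r * Z ^ 2) := by gcongr
      _ = _ := by ring
  have hC0 : ∀ r ∈ nearSlices n t, (0 : ℝ) < n.choose r := fun r hr => by
    exact_mod_cast Nat.choose_pos (mem_nearSlices.1 hr).1
  have hτ0 : ∀ r ∈ nearSlices n t, 0 < threshold n k r := fun r hr => by
    have := hC0 r hr
    unfold threshold
    positivity
  have hτ : ∀ r ∈ nearSlices n t, 1 ≤ threshold n k r * (4 * Y ^ 6 * Z ^ 4) := by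
    intro r hr
    have h1 := pow_le_pow_left₀ (by positivity) (hchoose r hr) 2
    have h2 : ((2 : ℝ) ^ n) ^ 2 = 4 ^ n := by rw [← pow_mul, mul_comm, pow_mul]; norm_num
    have h3 : (n : ℝ) ^ (2 * k) ≤ Y ^ 2 := by
      rw [pow_mul']
      gcongr
    rw [h2] at h1
    rw [threshold, div_mul_eq_mul_div, le_div_iff₀ (by positivity), one_mul]
    calc 4 * (n : ℝ) ^ (2 * k) * 4 ^ n ≤ 4 * Y ^ 2 * (Y ^ 2 * Z ^ 2 * n.choose r) ^ 2 := by gcongr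
      _ = _ := by ring
  have hdev : ∀ r ∈ nearSlices n t, (n : ℝ) ^ (2 * k) / (N * threshold n k r ^ 2) ≤ 16 / Y ^ 4 := by
    intro r hr
    have h0 := hτ0 r hr
    have h3 : (n : ℝ) ^ (2 * k) ≤ Y ^ 2 := by
      rw [pow_mul']
      gcongr
    have h1 := pow_le_pow_left₀ zero_le_one (hτ r hr) 2
    rw [div_le_div_iff₀ (by positivity) (by positivity)]
    calc (n : ℝ) ^ (2 * k) * Y ^ 4 ≤ Y ^ 2 * Y ^ 4 * 1 ^ 2 := by rw [one_pow, mul_one]; gcongr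
      _ ≤ Y ^ 2 * Y ^ 4 * (threshold n k r * (4 * Y ^ 6 * Z ^ 4)) ^ 2 := by gcongr
      _ = 16 * (Y ^ 18 * Z ^ 8 * threshold n k r ^ 2) := by ring
      _ ≤ 16 * (Y ^ 18 * Z ^ 18 * threshold n k r ^ 2) := by
          gcongr
          norm_num
      _ = 16 * (X ^ 18 * threshold n k r ^ 2) := by rw [hXdef]; ring
      _ ≤ 16 * (N * threshold n k r ^ 2) := by gcongr
  have hY4 : 16 / Y ^ 4 ≤ 16 / n := by
    gcongr
    calc (n : ℝ) ≤ Y := hnY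
      _ ≤ Y ^ 4 := le_self_pow₀ (by linarith) (by norm_num)
  have hYY : 64 / Y ^ 2 + 8 / Y ≤ 72 / n := by
    have h1 : 64 / Y ^ 2 ≤ 64 / (n : ℝ) := by
      gcongr
      exact hnY.trans (le_self_pow₀ (by linarith) (by norm_num))
    have h2 : 8 / Y ≤ 8 / (n : ℝ) := by gcongr
    calc 64 / Y ^ 2 + 8 / Y ≤ 64 / (n : ℝ) + 8 / n := add_le_add h1 h2
      _ = 72 / n := by ring
  refine ⟨N + N, D, ?_, ?_, fun l S F hF => lt_advantage (a := 16 / n) (b := 72 / n) ?_ ?_ ?_⟩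
  · rw [hX50]
    push_cast
    calc (N : ℝ) + N ≤ 2 ^ 2 * X ^ 18 := by linarith
      _ ≤ X ^ 2 * X ^ 18 := by gcongr
      _ = X ^ 20 := by ring
      _ ≤ X ^ 50 := pow_le_pow_right₀ (by linarith) (by norm_num)
  · rw [hX50]
    have h1 : (D.size : ℝ) ≤ 500 * (n * N ^ 2 * (n ^ k) ^ 2) := by exact_mod_cast hsize
    calc (D.size : ℝ) ≤ 500 * (n * N ^ 2 * (n ^ k) ^ 2) := h1
      _ ≤ 500 * (X * (2 * X ^ 18) ^ 2 * X ^ 2) := by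
          gcongr
          · exact hnY.trans hYX
          · exact hkY.trans hYX
      _ = 2000 * X ^ 39 := by ring
      _ ≤ 2 ^ 11 * X ^ 39 := by gcongr; norm_num
      _ ≤ X ^ 11 * X ^ 39 := by gcongr
      _ = X ^ 50 := by ring
  · intro s hs
    obtain ⟨r, hrn, h1, h2, h3⟩ := (hF s hs).le_energy
    have hr : r ∈ nearSlices n t := mem_nearSlices.2 ⟨hrn, h1, h2⟩
    have hk1 : ⌊d⌋₊ ≤ r := by
      have : (k : ℝ) ≤ r := by linarith
      exact_mod_cast this
    have hk2 : ⌊d⌋₊ + r ≤ n := by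
      have : (k : ℝ) + r ≤ n := by linarith
      exact_mod_cast this
    have h4 := h3 hk1 hk2
    rw [hD]
    refine le_trans ?_ (le_testProb hN0 hr (hτ0 r hr) ?_)
    · have := (hdev r hr).trans hY4
      linarith
    -- The threshold is half of the guaranteed energy `C(n,r)^2 / (2 n^{2k})`, divided by `4^n`.
    · rw [threshold, mul_div_assoc', div_mul_eq_mul_div, div_le_iff₀ (by positivity)]
      have h5 : (0 : ℝ) < 4 ^ n := by positivity
      nlinarith
  · rw [acceptProbRandom, sum_congr rfl fun R _ => hD R]
    refine (sum_testProb_le hN0 hτ0).trans (le_trans ?_ hYY)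
    have hterm : ∀ r ∈ nearSlices n t, 2 * ((n : ℝ) ^ k * n.choose r) / (threshold n k r * 4 ^ n) +
        4 * n ^ (2 * k) / (N * threshold n k r ^ 2) ≤ 8 / Y ^ 3 + 64 / Y ^ 4 := by
      intro r hr
      refine add_le_add ?_ ?_
      · have hC := hC0 r hr
        have h1 : 2 * ((n : ℝ) ^ k * n.choose r) / (threshold n k r * 4 ^ n) =
            8 * (n ^ k) ^ 3 / n.choose r := by
          rw [threshold, pow_mul']
          field_simp
          ring
        rw [h1, div_le_div_iff₀ hC (by positivity)]
        -- The Markov term is `8 n^{3k} / C(n,r)`. The slice size `Y^6` leaves `8 / Y^3`, which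
        -- survives the sum over at most `n + 1 ≤ Y^2` slices.
        have h2 : Y ^ 6 ≤ n.choose r := by
          have h3 := hYZ.trans (hchoose r hr)
          have h4 : Y ^ 6 * (Y ^ 2 * Z ^ 2) ≤ n.choose r * (Y ^ 2 * Z ^ 2) := by linarith
          exact le_of_mul_le_mul_right h4 (by positivity)
        calc 8 * ((n : ℝ) ^ k) ^ 3 * Y ^ 3 ≤ 8 * Y ^ 3 * Y ^ 3 := by gcongr
          _ = 8 * Y ^ 6 := by ring
          _ ≤ 8 * n.choose r := by gcongr
      · have := hdev r hr
        calc 4 * (n : ℝ) ^ (2 * k) / (N * threshold n k r ^ 2) =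
            4 * (n ^ (2 * k) / (N * threshold n k r ^ 2)) := by ring
          _ ≤ 4 * (16 / Y ^ 4) := by gcongr
          _ = _ := by ring
    refine (sum_le_card_nsmul _ _ _ hterm).trans ?_
    rw [nsmul_eq_mul]
    have hcard : ((nearSlices n t).card : ℝ) ≤ Y ^ 2 := by
      refine le_trans ?_ hnY2
      have := card_le_card (filter_subset (fun r : ℕ => (n : ℝ) / 2 - t / 2 ≤ r ∧
        (r : ℝ) ≤ (n : ℝ) / 2 + t / 2) (range (n + 1)))
      rw [card_range] at this
      exact_mod_cast this
    have hY0 : Y ≠ 0 := by positivity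
    calc ((nearSlices n t).card : ℝ) * (8 / Y ^ 3 + 64 / Y ^ 4) ≤
        Y ^ 2 * (8 / Y ^ 3 + 64 / Y ^ 4) := by gcongr
      _ = 64 / Y ^ 2 + 8 / Y := by field_simp; ring
  · have : 136 / (n : ℝ) = 48 / n + (16 / n + 72 / n) := by ring
    have h48 : 0 ≤ 48 / (n : ℝ) := by positivity
    linarith

end SliceDist

end

theorem mainTheorem5 :
    ∃ C : ℝ, 0 < C ∧
      ∀ t d : ℕ → ℝ,
        (∀ᶠ n : ℕ in atTop, t n ≤ (n : ℝ) / 4) →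
        (∀ᶠ n : ℕ in atTop, 1 ≤ d n) →
        (d =o[atTop] fun n : ℕ => (n : ℝ) / Real.logb 2 (n : ℝ)) →
        ∀ δ : ℝ, δ < 1 →
          ∀ᶠ n : ℕ in atTop,
            ∃ (m : ℕ) (D : SliceDist.Distinguisher n m),
              (m : ℝ) ≤ (2 : ℝ) ^ (C * (d n * Real.logb 2 (n : ℝ) + t n ^ 2 / (n : ℝ))) ∧
              (D.size : ℝ) ≤ (2 : ℝ) ^ (C * (d n * Real.logb 2 (n : ℝ) + t n ^ 2 / (n : ℝ))) ∧
              ∀ (k : ℕ) (S : PMF (SliceDist.Cube k))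
                (F : SliceDist.Cube k → SliceDist.Cube n → Bool),
                (∀ s ∈ S.support, SliceDist.IsConcentrated (t n) (d n) (1 / 2) (F s)) →
                δ < SliceDist.advantage D S F := by
  refine ⟨50, by norm_num, fun t d ht hd ho δ hδ => ?_⟩
  have hlarge : ∀ᶠ n : ℕ in atTop, δ < 1 - 136 / (n : ℝ) := by
    have h : Tendsto (fun n : ℕ => 1 - 136 / (n : ℝ)) atTop (nhds (1 - 0)) :=
      tendsto_const_nhds.sub (tendsto_const_div_atTop_nhds_zero_nat 136)
    rw [sub_zero] at h
    exact h.eventually_const_lt hδ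
  filter_upwards [ht, hd, ho.def (show (0 : ℝ) < 1 / 100 by norm_num), hlarge,
    eventually_ge_atTop 2] with n h1 h2 h3 h4 h5
  refine SliceDist.exists_distinguisher_of_bounds h5 h1 h2 ?_ h4
  have hn2 : (2 : ℝ) ≤ n := by exact_mod_cast h5
  have hlog : 1 ≤ Real.logb 2 n := by
    rw [Real.le_logb_iff_rpow_le one_lt_two (by linarith)]
    simpa using hn2
  rw [Real.norm_of_nonneg (by linarith), Real.norm_of_nonneg (by positivity)] at h3
  calc d n * Real.logb 2 n ≤ 1 / 100 * (n / Real.logb 2 n) * Real.logb 2 n := by gcongr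
    _ = n / 100 := by field_simp
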